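/- **Setting.** For positive integers $N,K,M$ with $2K<N$, let $x\in\{0,1\}^N$ be a binary signal with exactly $K$ ones, let $a_1,\dots,a_N\in\mathbb R^M$ be the columns of a matrix $\Phi\in\mathbb R^{M\times N}$ with i.i.d. $\mathcal N(0,1/M)$ entries, and let $w\in\mathbb R^M$, independent of $\Phi$, have i.i.d. $\mathcal N(0,\sigma_w^2)$ entries, where $\sigma_w^2\ge 0$. The measurement is $y=\Phi x+w$, and the normalized noise variance is $\tilde\sigma_w^2=M\sigma_w^2$. **Algorithm (MAP-MP).** Start with $S^0=\emptyset$, $r^0=y$. In iteration $k=1,\dots,K$ compute $z_n^k=a_n^{T}r^{k-1}/\|a_n\|_2$ and $$\Lambda(z_n^k)=\frac{(z_n^k)^2}{2\frac{K-k+1}{M}+2\sigma_w^2}-\frac{(z_n^k-1)^2}{2\frac{K-k}{M}+2\sigma_w^2}+\frac12\ln\frac{K-k+1+M\sigma_w^2}{K-k+M\sigma_w^2}+\ln\frac{K}{N-K},$$ except that $\Lambda(z_n^K)=\frac{M(z_n^K)^2}{2}+\ln\frac{K}{N-K}$ in the last iteration $k=K$ if $\sigma_w^2=0$. Let $J^k$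 be an index that maximizes $\Lambda(z_n^k)$ over the indices $n\notin S^{k-1}$ (ties are broken by an arbitrary deterministic rule that depends only on the set of maximizers). Put $S^k=S^{k-1}\cup\{J^k\}$, let $\hat x^k$ be the indicator vector of $S^k$, and put $r^k=y-\Phi\hat x^k$. **Theorem.** Consider any sequence of such problems, with $M$, $\sigma_w^2$, $x$ and the tie-breaking rule allowed to vary with the problem, along which $N\to\infty$ and $K\to\infty$. 1. If for some fixed $\varepsilon>0$ $$M\ \ge\ (1+\varepsilon)\cdot 2\,(4K-2+4\tilde\sigma_w^2)\,\ln(N-K)$$ along the sequence, then the probability that $\hat x^K=x$, i.e. that MAP-MP recovers $x$ exactly within $K$ iterations, tends to $1$. 2. Consequently a number of measurements of order $(K+\tilde\sigma_w^2)\ln N$ suffices: there is an absolute constant $C>0$ such that the same conclusion holds whenever $M\ge C\,(K+\tilde\sigma_w^2)\ln N$ along the sequence. -/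

import Mathlib

open MeasureTheory ProbabilityTheory Filter Topology
open scoped NNReal Matrix

noncomputable section

namespace MAPMP

/-- A binary signal `x ∈ {0,1}^N` with exactly `K` nonzero entries. -/
def IsBinarySparse {N : ℕ} (K : ℕ) (x : Fin N → ℝ) : Prop :=
  (∀ n, x n = 0 ∨ x n = 1) ∧ {n | x n ≠ 0}.ncard = K

/-- Joint law of the sensing matrix and the noise. The matrix is given by its columns
`a n ∈ ℝ^M`; all its entries are i.i.d. `N(0, 1/M)`, the entries of the noise are i.i.d. `N(0, v)`,
and matrix and noise are independent. -/
def law (N M : ℕ) (v : ℝ≥0) : Measure ((Fin N → Fin M → ℝ) × (Fin M → ℝ)) :=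
  (Measure.pi fun _ : Fin N => Measure.pi fun _ : Fin M => gaussianReal 0 ((M : ℝ≥0)⁻¹)).prod
    (Measure.pi fun _ : Fin M => gaussianReal 0 v)

/-- The measurement `y = Φ x + w`, where `Φ` has the columns `a n`. -/
def measurement {N M : ℕ} (x : Fin N → ℝ) (a : Fin N → Fin M → ℝ) (w : Fin M → ℝ) : Fin M → ℝ :=
  ∑ n, x n • a n + w

/-- The normalized correlation `z = aᵀ r / ‖a‖₂`. -/
def corr {M : ℕ} (a r : Fin M → ℝ) : ℝ :=
  (a ⬝ᵥ r) / √(a ⬝ᵥ a)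

/-- The log-MAP ratio `Λ(z)` of iteration `k ∈ {1, …, K}`, with noise variance `v`. In the last
iteration of the noise-free case the variance under the support hypothesis vanishes, and the ratio
is replaced by its noise-free form. -/
def mapRatio (N K M : ℕ) (v : ℝ≥0) (k : ℕ) (z : ℝ) : ℝ :=
  open Classical in
  if v = 0 ∧ k = K then
    (M : ℝ) * z ^ 2 / 2 + Real.log ((K : ℝ) / ((N : ℝ) - K))
  else
    z ^ 2 / (2 * (((K : ℝ) - k + 1) / M + v)) - (z - 1) ^ 2 / (2 * (((K : ℝ) - k) / M + v))
      + 1 / 2 * Real.log (((K : ℝ) - k + 1 + M * v) / ((K : ℝ) - k + M * v))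
      + Real.log ((K : ℝ) / ((N : ℝ) - K))

/-- The signal estimate attached to a support estimate `S`: one on `S`, zero elsewhere. -/
def estimate {N : ℕ} (S : Finset (Fin N)) : Fin N → ℝ :=
  fun n => if n ∈ S then 1 else 0

/-- The residual `r = y - Φ x̂` for the support estimate `S`. -/
def residual {N M : ℕ} (a : Fin N → Fin M → ℝ) (y : Fin M → ℝ) (S : Finset (Fin N)) :
    Fin M → ℝ :=
  y - ∑ n, estimate S n • a n

/-- The not yet selected indices whose log-MAP ratio in iteration `k` is maximal among the not yet
selected indices, where `S` is the support estimate produced by iteration `k - 1`. -/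
def maximizers {N M : ℕ} (K : ℕ) (v : ℝ≥0) (a : Fin N → Fin M → ℝ) (y : Fin M → ℝ) (k : ℕ)
    (S : Finset (Fin N)) : Finset (Fin N) :=
  open Classical in
  Sᶜ.filter fun n => ∀ j ∈ Sᶜ,
    mapRatio N K M v k (corr (a j) (residual a y S)) ≤
      mapRatio N K M v k (corr (a n) (residual a y S))

/-- The support estimate of MAP-MP after `k` iterations on the input `(a, y)`, with known sparsity
`K` and noise variance `v`. The rule `c` breaks ties: it picks an element of the set of
maximizers. -/
def support {N M : ℕ} (c : Finset (Fin N) → Fin N) (K : ℕ) (v : ℝ≥0) (a : Fin N → Fin M → ℝ)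
    (y : Fin M → ℝ) : ℕ → Finset (Fin N)
  | 0 => ∅
  | k + 1 =>
      insert (c (maximizers K v a y (k + 1) (support c K v a y k))) (support c K v a y k)

/-- The probability that the MAP-MP estimate after `K` iterations equals the signal `x`. -/
def successProb {N : ℕ} (c : Finset (Fin N) → Fin N) (K M : ℕ) (v : ℝ≥0) (x : Fin N → ℝ) : ℝ :=
  (law N M v).real {ω | estimate (support c K v ω.1 (measurement x ω.1 ω.2) K) = x}

end MAPMP

end

/-! The residual depends on the columns through all earlier choices. This dependence is removed by
an oracle: the same greedy rule confined to the true support `T`. Its path reads only the columns in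
`T` and the noise (`oracle_congr`), so a column off `T` is independent of its residual, and one
Gaussian tail bound per iteration and per such column suffices (`law_off_support_tail`). As long as
some remaining support index beats every index off `T`, algorithm and oracle coincide
(`support_eq_oracle`).

Comparing ratios amounts to comparing correlations, because Λ increases up to a vertex that the
relevant pairs do not pass on average (`mapRatio_lt_mapRatio`). Let U be the set of remaining
indices, A the sum of their columns and r = A + w. The numbers a_j · r, j ∈ U, add up to |A|² + A ·
w with |A|² close to |U|, so some j reaches the average (`exists_winner`).

There are two regimes, separated by m₀ = K / √log(N-K). If |U| ≥ m₀, then |A · w| ≤ δ|U|, the winner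
is close to 1, and the correlations off `T` stay below 4/5. If |U| ≤ m₀, then A barely correlates
with columns off `T`, and the noise decides: if |a_n · w| stays slightly below 1/2 for all n, the
winner lies above 1/2 and the others below. That noise event does not involve the iteration, so its
union bound costs only a factor N. As |w|² ≤ (1+δ)(K + Mv), its tail is about exp(-M / (8(K + Mv))),
which is where 8(K + Mv) log(N-K) comes from. -/

namespace MAPMP

/-! ### Gaussian vectors and sums of columns -/

/-- The centered Gaussian law on `ℝ^M` with covariance `s • 1`. -/
noncomputable abbrev gaussianVec (M : ℕ) (s : ℝ≥0) : Measure (Fin M → ℝ) :=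
  Measure.pi fun _ => gaussianReal 0 s

lemma gaussianVec_zero (M : ℕ) : gaussianVec M 0 = Measure.dirac 0 := by
  refine Measure.pi_eq fun s hs => ?_
  simp only [gaussianReal_zero_var]
  rw [Measure.dirac_apply' _ (MeasurableSet.univ_pi hs)]
  simp_rw [Measure.dirac_apply' _ (hs _)]
  by_cases h : ∀ i, (0 : ℝ) ∈ s i
  · rw [Set.indicator_of_mem (by simpa [Set.mem_pi] using h)]
    simp [h]
  · rw [Set.indicator_of_notMem (by simpa [Set.mem_pi] using h)]
    push Not at h
    obtain ⟨i, hi⟩ := h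
    exact (Finset.prod_eq_zero (Finset.mem_univ i) (by simp [hi])).symm

lemma gaussianVec_conv (M : ℕ) (s t : ℝ≥0) :
    gaussianVec M s ∗ gaussianVec M t = gaussianVec M (s + t) := by
  rw [Measure.conv, gaussianVec, gaussianVec,
    ← (measurePreserving_arrowProdEquivProdArrow ℝ ℝ (Fin M) (fun _ => gaussianReal 0 s)
      (fun _ => gaussianReal 0 t)).map_eq, Measure.map_map (by fun_prop) (by fun_prop)]
  have h : ((fun x : (Fin M → ℝ) × (Fin M → ℝ) => x.1 + x.2) ∘
      (MeasurableEquiv.arrowProdEquivProdArrow ℝ ℝ (Fin M))) =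
      fun x i => (fun p : ℝ × ℝ => p.1 + p.2) (x i) := by
    ext x i; rfl
  have hc : ((gaussianReal 0 s).prod (gaussianReal 0 t)).map (fun p : ℝ × ℝ => p.1 + p.2) =
      gaussianReal 0 (s + t) := by
    simpa [Measure.conv] using gaussianReal_conv_gaussianReal (m₁ := 0) (m₂ := 0) (v₁ := s) (v₂ := t)
  have : ∀ _ : Fin M, SigmaFinite
      (((gaussianReal 0 s).prod (gaussianReal 0 t)).map (fun p : ℝ × ℝ => p.1 + p.2)) := by
    intro _; rw [hc]; infer_instance
  rw [h, Measure.pi_map_pi (f := fun (_ : Fin M) (p : ℝ × ℝ) => p.1 + p.2) (fun _ => by fun_prop)]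
  simp_rw [hc]

/-- A sum of independent Gaussian columns is Gaussian. -/
lemma map_sum_columns (N M : ℕ) (s : ℝ≥0) (U : Finset (Fin N)) :
    (Measure.pi fun _ : Fin N => gaussianVec M s).map (fun a => ∑ j ∈ U, a j) =
      gaussianVec M (U.card * s) := by
  have hind : iIndepFun (fun (j : Fin N) (a : Fin N → Fin M → ℝ) => a j)
      (Measure.pi fun _ : Fin N => gaussianVec M s) :=
    iIndepFun_pi (X := fun _ x => x) (fun _ => aemeasurable_id)
  induction U using Finset.induction_on with
  | empty =>
    simp [gaussianVec_zero, Measure.map_const]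
  | insert j U hj ih =>
    have h := (hind.indepFun_finsetSum_of_notMem (fun j => measurable_pi_apply j) hj).symm
    have h2 := h.map_add_eq_map_conv_map (measurable_pi_apply j) (by fun_prop)
    have e1 : (∑ j ∈ U, fun a : Fin N → Fin M → ℝ => a j) = fun a => ∑ j ∈ U, a j := by
      ext a; simp
    rw [e1, ih, (measurePreserving_eval (fun _ : Fin N => gaussianVec M s) j).map_eq,
      gaussianVec_conv] at h2
    have e2 : (fun a : Fin N → Fin M → ℝ => ∑ j ∈ insert j U, a j) =
        (fun a => a j) + fun a => ∑ j ∈ U, a j := by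
      ext a; simp [Finset.sum_insert hj]
    rw [e2, h2, Finset.card_insert_of_notMem hj]
    congr 2
    push_cast; ring

instance (N M : ℕ) (v : ℝ≥0) : IsProbabilityMeasure (law N M v) := by
  unfold law; infer_instance

lemma map_sum_columns_add_noise (N M : ℕ) (v : ℝ≥0) (U : Finset (Fin N)) :
    (law N M v).map (fun ω => ∑ j ∈ U, ω.1 j + ω.2) =
      gaussianVec M (U.card * (M : ℝ≥0)⁻¹ + v) := by
  rw [← gaussianVec_conv, ← map_sum_columns, Measure.conv]
  conv_rhs => rw [← Measure.map_id (μ := gaussianVec M v)]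
  rw [Measure.map_prod_map _ _ (by fun_prop) (by fun_prop),
    Measure.map_map (by fun_prop) (by fun_prop)]
  rfl

lemma map_fst_law (N M : ℕ) (v : ℝ≥0) :
    (law N M v).map Prod.fst = Measure.pi fun _ : Fin N => gaussianVec M (M : ℝ≥0)⁻¹ := by
  simp [law, Measure.map_fst_prod]

/-! ### Chernoff bounds for norms and inner products -/

/-- Chernoff's bound for a sum of functions of independent coordinates. -/
lemma measureReal_pi_le_sum_le {ι : Type*} [Fintype ι] (μ : ι → Measure ℝ)
    [∀ i, IsProbabilityMeasure (μ i)] (f : ι → ℝ → ℝ)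
    (hf : ∀ i, Integrable (fun y => Real.exp (f i y)) (μ i)) (t : ℝ) :
    (Measure.pi μ).real {x | t ≤ ∑ i, f i (x i)} ≤
      Real.exp (-t) * ∏ i, ∫ y, Real.exp (f i y) ∂μ i := by
  have h := mul_meas_ge_le_integral_of_nonneg (μ := Measure.pi μ)
    (f := fun x => ∏ i, Real.exp (f i (x i)))
    (ae_of_all _ fun x => Finset.prod_nonneg fun i _ => (Real.exp_pos _).le)
    (Integrable.fintype_prod hf) (Real.exp t)
  rw [integral_fintype_prod_eq_prod (fun i y => Real.exp (f i y))] at h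
  have e : {x : ι → ℝ | Real.exp t ≤ ∏ i, Real.exp (f i (x i))} = {x | t ≤ ∑ i, f i (x i)} := by
    ext x
    simp [← Real.exp_sum]
  rw [e] at h
  rw [Real.exp_neg, ← div_eq_inv_mul, le_div_iff₀' (Real.exp_pos _)]
  exact h

/-- The integral is (1 - 2cs)^(-1/2), and 1 + u ≤ exp u with u = 2cs / (1 - 2cs) turns it into an
exponential. The sign of c is free: c > 0 serves the upper chi-square tail, c < 0 the lower one. -/
lemma integral_exp_sq_gaussian {s : ℝ≥0} {c : ℝ} (h : 2 * (c * s) < 1) :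
    Integrable (fun y => Real.exp (c * y ^ 2)) (gaussianReal 0 s) ∧
      ∫ y, Real.exp (c * y ^ 2) ∂gaussianReal 0 s ≤ Real.exp (c * s / (1 - 2 * (c * s))) := by
  rcases eq_or_ne s 0 with rfl | hs
  · simp [gaussianReal_zero_var, integrable_dirac]
  have hs' : 0 < (s : ℝ) := by exact_mod_cast pos_iff_ne_zero.2 hs
  set b : ℝ := (1 - 2 * (c * s)) / (2 * s) with hb
  have hb0 : 0 < b := div_pos (by linarith) (by linarith)
  have e : ∀ y : ℝ, gaussianPDFReal 0 s y * Real.exp (c * y ^ 2) =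
      (√(2 * Real.pi * s))⁻¹ * Real.exp (-b * y ^ 2) := by
    intro y
    rw [gaussianPDFReal, mul_assoc, ← Real.exp_add]
    congr 2
    rw [hb]; field_simp; ring
  constructor
  · rw [gaussianReal_of_var_ne_zero _ hs, gaussianPDF_def,
      integrable_withDensity_iff_integrable_smul' (by fun_prop) (by simp)]
    have : (fun y => (ENNReal.ofReal (gaussianPDFReal 0 s y)).toReal • Real.exp (c * y ^ 2)) =
        fun y => (√(2 * Real.pi * s))⁻¹ * Real.exp (-b * y ^ 2) := by
      ext y
      rw [ENNReal.toReal_ofReal (gaussianPDFReal_nonneg _ _ _), smul_eq_mul, e]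
    rw [this]
    exact (integrable_exp_neg_mul_sq hb0).const_mul _
  · rw [integral_gaussianReal_eq_integral_smul hs]
    simp_rw [smul_eq_mul, e]
    rw [integral_const_mul, integral_gaussian, ← Real.sqrt_inv, ← Real.sqrt_mul (by positivity)]
    have e2 : (2 * Real.pi * s)⁻¹ * (Real.pi / b) = (1 - 2 * (c * s))⁻¹ := by
      have h1 : (1 - 2 * (c * s)) ≠ 0 := by linarith
      rw [hb]; field_simp
    rw [e2, Real.sqrt_le_iff]
    refine ⟨(Real.exp_pos _).le, ?_⟩
    rw [← Real.exp_nat_mul]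
    have h1 : 0 < 1 - 2 * (c * s) := by linarith
    have h2 := Real.add_one_le_exp (2 * (c * s) / (1 - 2 * (c * s)))
    have e3 : 2 * (c * s) / (1 - 2 * (c * s)) + 1 = (1 - 2 * (c * s))⁻¹ := by
      rw [inv_eq_one_div, div_add_one h1.ne']; congr 1; ring
    rw [e3] at h2
    refine h2.trans (le_of_eq ?_)
    congr 1
    push_cast; ring

lemma dotProduct_self_eq_sum {M : ℕ} (g : Fin M → ℝ) : g ⬝ᵥ g = ∑ i, g i ^ 2 := by
  simp [dotProduct, sq]

lemma measurable_dotProduct {M : ℕ} {Ω : Type*} [MeasurableSpace Ω] {f g : Ω → Fin M → ℝ}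
    (hf : Measurable f) (hg : Measurable g) : Measurable fun ω => f ω ⬝ᵥ g ω := by
  unfold dotProduct; fun_prop

/-- Upper tail of a chi-square law, uniformly in the variance. -/
lemma gaussianVec_upper_tail {M : ℕ} {s : ℝ≥0} {s₀ δ : ℝ} (hs₀ : 0 < s₀) (hs : s ≤ s₀)
    (hδ : 0 < δ) (hδ1 : δ ≤ 1) :
    (gaussianVec M s).real {g | (1 + δ) * (M * s₀) ≤ g ⬝ᵥ g} ≤ Real.exp (-(δ ^ 2 / 16) * M) := by
  -- With this c each coordinate contributes at most -(δ/8)(1 + δ) + (δ/8)(1 + δ/2) = -δ²/16 to the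
  -- exponent.
  set c : ℝ := δ / 8 / s₀ with hc
  have hc0 : 0 < c := by positivity
  have hcs : c * s ≤ δ / 8 := by
    calc c * s ≤ c * s₀ := by gcongr
      _ = δ / 8 := by rw [hc]; field_simp
  have hcs0 : 0 ≤ c * s := by positivity
  obtain ⟨hI, hb⟩ := integral_exp_sq_gaussian (s := s) (c := c) (by linarith)
  have h := measureReal_pi_le_sum_le (fun _ : Fin M => gaussianReal 0 s) (fun _ y => c * y ^ 2)
    (fun _ => hI) (c * ((1 + δ) * (M * s₀)))
  have e : {x : Fin M → ℝ | c * ((1 + δ) * (M * s₀)) ≤ ∑ i, c * x i ^ 2} =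
      {g | (1 + δ) * (M * s₀) ≤ g ⬝ᵥ g} := by
    ext g
    rw [Set.mem_ofPred_eq, Set.mem_ofPred_eq, ← Finset.mul_sum, ← dotProduct_self_eq_sum,
      mul_le_mul_iff_right₀ hc0]
  rw [e] at h
  refine h.trans ?_
  rw [Finset.prod_const, Finset.card_univ, Fintype.card_fin]
  have hb2 : ∫ y, Real.exp (c * y ^ 2) ∂gaussianReal 0 s ≤ Real.exp (δ / 8 * (1 + δ / 2)) := by
    refine hb.trans (Real.exp_le_exp.2 ?_)
    rw [div_le_iff₀ (by linarith)]
    nlinarith [mul_nonneg hδ.le (sub_nonneg.2 hδ1), mul_nonneg (sub_nonneg.2 hcs) hδ.le,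
      mul_nonneg (mul_nonneg (sub_nonneg.2 hcs) hδ.le) hδ.le]
  calc _ ≤ Real.exp (-(c * ((1 + δ) * (M * s₀)))) * Real.exp (δ / 8 * (1 + δ / 2)) ^ M := by
        gcongr
    _ = Real.exp (-(δ ^ 2 / 16) * M) := by
        rw [← Real.exp_nat_mul, ← Real.exp_add]
        congr 1
        rw [hc]; field_simp; ring

/-- Lower tail of a chi-square law. -/
lemma gaussianVec_lower_tail {M : ℕ} {s : ℝ≥0} {δ : ℝ} (hs : s ≠ 0) (hδ : 0 < δ) :
    (gaussianVec M s).real {g | g ⬝ᵥ g ≤ (1 - δ) * (M * s)} ≤ Real.exp (-(δ ^ 2 / 16) * M) := by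
  have hs' : 0 < (s : ℝ) := by exact_mod_cast pos_iff_ne_zero.2 hs
  -- This choice yields the exponent δ²/8, weakened at the end to δ²/16 so that both tails share one
  -- bound.
  set c : ℝ := δ / 4 / s with hc
  have hc0 : 0 < c := by positivity
  have hcs : c * s = δ / 4 := by rw [hc]; field_simp
  obtain ⟨hI, hb⟩ := integral_exp_sq_gaussian (s := s) (c := -c) (by nlinarith)
  have h := measureReal_pi_le_sum_le (fun _ : Fin M => gaussianReal 0 s) (fun _ y => -c * y ^ 2)
    (fun _ => hI) (-c * ((1 - δ) * (M * s)))
  have e : {x : Fin M → ℝ | -c * ((1 - δ) * (M * s)) ≤ ∑ i, -c * x i ^ 2} =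
      {g | g ⬝ᵥ g ≤ (1 - δ) * (M * s)} := by
    ext g
    rw [Set.mem_ofPred_eq, Set.mem_ofPred_eq, ← Finset.mul_sum, ← dotProduct_self_eq_sum,
      neg_mul, neg_mul, neg_le_neg_iff, mul_le_mul_iff_right₀ hc0]
  rw [e] at h
  refine h.trans ?_
  rw [Finset.prod_const, Finset.card_univ, Fintype.card_fin]
  have hb2 : ∫ y, Real.exp (-c * y ^ 2) ∂gaussianReal 0 s ≤
      Real.exp (-(δ / 4) * (1 - δ / 2)) := by
    refine hb.trans (Real.exp_le_exp.2 ?_)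
    rw [neg_mul, hcs, div_le_iff₀ (by linarith)]
    nlinarith [mul_nonneg hδ.le hδ.le, mul_nonneg (mul_nonneg hδ.le hδ.le) hδ.le]
  calc _ ≤ Real.exp (-(-c * ((1 - δ) * (M * s)))) * Real.exp (-(δ / 4) * (1 - δ / 2)) ^ M := by
        gcongr
    _ = Real.exp (-(δ ^ 2 / 8) * M) := by
        rw [← Real.exp_nat_mul, ← Real.exp_add]
        congr 1
        rw [hc]; field_simp; ring
    _ ≤ _ := by
        gcongr
        nlinarith [sq_nonneg δ]

lemma gaussianVec_dotProduct_tail_one_sided {M : ℕ} {s : ℝ≥0} (hs : s ≠ 0) (r : Fin M → ℝ)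
    {R t : ℝ} (hR : 0 < R) (hr : r ⬝ᵥ r ≤ R) (ht : 0 ≤ t) :
    (gaussianVec M s).real {b | t ≤ b ⬝ᵥ r} ≤ Real.exp (-(t ^ 2 / (2 * s * R))) := by
  have hs' : 0 < (s : ℝ) := by exact_mod_cast pos_iff_ne_zero.2 hs
  rcases ht.eq_or_lt with rfl | ht
  · simp [measureReal_le_one]
  -- The minimizer of -lt + l²sR/2.
  set l : ℝ := t / (s * R) with hl
  have hl0 : 0 < l := by positivity
  have h := measureReal_pi_le_sum_le (fun _ : Fin M => gaussianReal 0 s)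
    (fun i y => l * r i * y) (fun i => integrable_exp_mul_gaussianReal _) (l * t)
  have hm : ∀ i, ∫ y, Real.exp (l * r i * y) ∂gaussianReal 0 s =
      Real.exp (l ^ 2 * s / 2 * r i ^ 2) := by
    intro i
    have := congrFun (mgf_id_gaussianReal (μ := 0) (v := s)) (l * r i)
    simp only [mgf, id] at this
    rw [this]
    congr 1
    ring
  simp_rw [hm] at h
  rw [← Real.exp_sum, ← Finset.mul_sum, ← dotProduct_self_eq_sum, ← Real.exp_add] at h
  have e : {x : Fin M → ℝ | l * t ≤ ∑ i, l * r i * x i} = {b | t ≤ b ⬝ᵥ r} := by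
    ext b
    have : ∑ i, l * r i * b i = l * (b ⬝ᵥ r) := by
      rw [dotProduct, Finset.mul_sum]; exact Finset.sum_congr rfl fun i _ => by ring
    rw [Set.mem_ofPred_eq, Set.mem_ofPred_eq, this, mul_le_mul_iff_right₀ hl0]
  rw [e] at h
  refine h.trans (Real.exp_le_exp.2 ?_)
  have h1 : l ^ 2 * s / 2 * (r ⬝ᵥ r) ≤ l ^ 2 * s / 2 * R := by gcongr
  have h2 : -(l * t) + l ^ 2 * s / 2 * R = -(t ^ 2 / (2 * s * R)) := by
    rw [hl]; field_simp; ring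
  linarith

lemma gaussianVec_dotProduct_tail {M : ℕ} {s : ℝ≥0} (hs : s ≠ 0) (r : Fin M → ℝ)
    {R t : ℝ} (hR : 0 < R) (hr : r ⬝ᵥ r ≤ R) (ht : 0 ≤ t) :
    (gaussianVec M s).real {b | t ≤ |b ⬝ᵥ r|} ≤ 2 * Real.exp (-(t ^ 2 / (2 * s * R))) := by
  have h1 := gaussianVec_dotProduct_tail_one_sided hs r hR hr ht
  have h2 := gaussianVec_dotProduct_tail_one_sided hs (-r) hR (by simpa using hr) ht
  have hsub : {b : Fin M → ℝ | t ≤ |b ⬝ᵥ r|} ⊆ {b | t ≤ b ⬝ᵥ r} ∪ {b | t ≤ b ⬝ᵥ (-r)} := by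
    intro b hb
    simpa [le_abs] using hb
  calc _ ≤ _ := measureReal_mono hsub
    _ ≤ _ := measureReal_union_le _ _
    _ ≤ _ := by linarith

/-! ### Tail bounds under the joint law by freezing all but one source of randomness -/

lemma measure_le_of_real_le {α : Type*} [MeasurableSpace α] {μ : Measure α} [IsFiniteMeasure μ]
    {s : Set α} {p : ℝ} (h : μ.real s ≤ p) : μ s ≤ ENNReal.ofReal p := by
  rw [← ENNReal.ofReal_toReal (measure_ne_top μ s)]
  exact ENNReal.ofReal_le_ofReal h

/-- A bound on all sections gives a bound for a product measure. -/
lemma measureReal_prod_le_of_sections {α β : Type*} [MeasurableSpace α] [MeasurableSpace β]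
    (μ : Measure α) (ν : Measure β) [IsProbabilityMeasure μ] [IsProbabilityMeasure ν]
    {s : Set (α × β)} (hs : MeasurableSet s) {p : ℝ} (hp : 0 ≤ p)
    (h : ∀ y, μ.real {x | (x, y) ∈ s} ≤ p) : (μ.prod ν).real s ≤ p := by
  refine ENNReal.toReal_le_of_le_ofReal hp ?_
  rw [Measure.prod_apply_symm hs]
  calc _ ≤ ∫⁻ _, ENNReal.ofReal p ∂ν := lintegral_mono fun y => measure_le_of_real_le (h y)
    _ = ENNReal.ofReal p := by simp

/-- Resampling one coordinate of an i.i.d. family preserves the law. This allows everything except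
column n to be frozen while that column is still random. -/
lemma map_update_pi {ι E : Type*} [Fintype ι] [DecidableEq ι] [MeasurableSpace E] (γ : Measure E)
    [IsProbabilityMeasure γ] (n : ι) :
    (γ.prod (Measure.pi fun _ : ι => γ)).map (fun p => Function.update p.2 n p.1) =
      Measure.pi fun _ : ι => γ := by
  have hmeas : Measurable fun p : E × (ι → E) => Function.update p.2 n p.1 := by
    rw [measurable_pi_iff]
    intro j
    by_cases hj : j = n
    · subst hj; simpa using measurable_fst
    · simp only [Function.update_of_ne hj]; fun_prop
  refine (Measure.pi_eq fun s hs => ?_).symm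
  rw [Measure.map_apply hmeas (MeasurableSet.univ_pi hs)]
  have e : (fun p : E × (ι → E) => Function.update p.2 n p.1) ⁻¹' Set.univ.pi s =
      s n ×ˢ Set.univ.pi (Function.update s n Set.univ) := by
    ext ⟨b, a⟩
    simp only [Set.mem_preimage, Set.mem_pi, Set.mem_univ, true_implies, Set.mem_prod]
    constructor
    · intro h
      refine ⟨by simpa using h n, fun j => ?_⟩
      by_cases hj : j = n
      · subst hj; simp
      · simpa [hj] using h j
    · rintro ⟨h1, h2⟩ j
      by_cases hj : j = n
      · subst hj; simpa using h1
      · simpa [hj] using h2 j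
  rw [e, Measure.prod_prod, Measure.pi_pi, ← Finset.mul_prod_erase _ _ (Finset.mem_univ n),
    ← Finset.mul_prod_erase _ (fun i => γ (s i)) (Finset.mem_univ n)]
  simp only [Function.update_self, measure_univ, one_mul]
  congr 1
  refine Finset.prod_congr rfl fun j hj => ?_
  rw [Function.update_of_ne (Finset.ne_of_mem_erase hj)]

/-- The correlation of a column with a vector that does not depend on that column. -/
lemma law_column_dotProduct_tail {N M : ℕ} (hM : 0 < M) (v : ℝ≥0) (n : Fin N)
    (F : (Fin N → Fin M → ℝ) → (Fin M → ℝ) → Fin M → ℝ)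
    (hF : ∀ a w b, F (Function.update a n b) w = F a w) {R t : ℝ} (hR : 0 < R) (ht : 0 ≤ t)
    (hs : MeasurableSet {ω : (Fin N → Fin M → ℝ) × (Fin M → ℝ) |
      F ω.1 ω.2 ⬝ᵥ F ω.1 ω.2 ≤ R ∧ t ≤ |ω.1 n ⬝ᵥ F ω.1 ω.2|}) :
    (law N M v).real {ω | F ω.1 ω.2 ⬝ᵥ F ω.1 ω.2 ≤ R ∧ t ≤ |ω.1 n ⬝ᵥ F ω.1 ω.2|} ≤
      2 * Real.exp (-(t ^ 2 * M / (2 * R))) := by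
  have hM' : (0 : ℝ) < M := by exact_mod_cast hM
  refine measureReal_prod_le_of_sections _ _ hs (by positivity) fun w => ?_
  have hsec := hs.preimage (measurable_prodMk_right (y := w))
  change MeasurableSet {a | F a w ⬝ᵥ F a w ≤ R ∧ t ≤ |a n ⬝ᵥ F a w|} at hsec
  change (Measure.pi _).real {a | F a w ⬝ᵥ F a w ≤ R ∧ t ≤ |a n ⬝ᵥ F a w|} ≤ _
  have hmeas : Measurable fun p : (Fin M → ℝ) × (Fin N → Fin M → ℝ) =>
      Function.update p.2 n p.1 := by
    rw [measurable_pi_iff]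
    intro j
    by_cases hj : j = n
    · subst hj; simpa using measurable_fst
    · simp only [Function.update_of_ne hj]; fun_prop
  -- Column n is replaced by a fresh copy b. Since `F` does not see it, for fixed a and w only the
  -- inner product of b with a constant vector remains.
  rw [← map_update_pi (gaussianVec M (M : ℝ≥0)⁻¹) n, map_measureReal_apply hmeas hsec]
  refine measureReal_prod_le_of_sections _ _ (hmeas hsec) (by positivity) fun a => ?_
  simp only [Set.mem_preimage, Set.mem_ofPred_eq, hF, Function.update_self]
  by_cases h : F a w ⬝ᵥ F a w ≤ R
  · simp only [h, true_and]
    refine (gaussianVec_dotProduct_tail (by simp; omega) _ hR h ht).trans (le_of_eq ?_)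
    congr 3
    push_cast; field_simp
  · simp [h]; positivity

/-- The correlation of a sum of columns with the noise. -/
lemma law_sum_dotProduct_noise_tail {N M : ℕ} (hM : 0 < M) (v : ℝ≥0) {U : Finset (Fin N)}
    (hU : U.Nonempty) {R t : ℝ} (hR : 0 < R) (ht : 0 ≤ t) :
    (law N M v).real {ω | ω.2 ⬝ᵥ ω.2 ≤ R ∧ t ≤ |(∑ j ∈ U, ω.1 j) ⬝ᵥ ω.2|} ≤
      2 * Real.exp (-(t ^ 2 * M / (2 * U.card * R))) := by
  have hM' : (0 : ℝ) < M := by exact_mod_cast hM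
  have hU' : (0 : ℝ) < U.card := by exact_mod_cast hU.card_pos
  have m1 : Measurable fun ω : (Fin N → Fin M → ℝ) × (Fin M → ℝ) => ω.2 ⬝ᵥ ω.2 :=
    measurable_dotProduct (by fun_prop) (by fun_prop)
  have m2 : Measurable fun ω : (Fin N → Fin M → ℝ) × (Fin M → ℝ) =>
      |(∑ j ∈ U, ω.1 j) ⬝ᵥ ω.2| :=
    (measurable_dotProduct (by fun_prop) (by fun_prop)).abs
  refine measureReal_prod_le_of_sections _ _
    ((measurableSet_le m1 measurable_const).inter (measurableSet_le measurable_const m2))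
    (by positivity) fun w => ?_
  by_cases h : w ⬝ᵥ w ≤ R
  · have m3 : MeasurableSet {b : Fin M → ℝ | t ≤ |b ⬝ᵥ w|} :=
      measurableSet_le measurable_const (measurable_dotProduct measurable_id (by fun_prop)).abs
    have := gaussianVec_dotProduct_tail (M := M) (s := U.card * (M : ℝ≥0)⁻¹)
      (by simp [hU.ne_empty]; omega) w hR h ht
    rw [← map_sum_columns, map_measureReal_apply (by fun_prop) m3] at this
    have e : {a : Fin N → Fin M → ℝ | (a, w) ∈ {ω : (Fin N → Fin M → ℝ) × (Fin M → ℝ) |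
        ω.2 ⬝ᵥ ω.2 ≤ R} ∩ {ω | t ≤ |(∑ j ∈ U, ω.1 j) ⬝ᵥ ω.2|}} =
        (fun a => ∑ j ∈ U, a j) ⁻¹' {b | t ≤ |b ⬝ᵥ w|} := by
      ext a; simp [h]
    rw [e]
    refine this.trans (le_of_eq ?_)
    congr 3
    push_cast; field_simp
  · have : {a : Fin N → Fin M → ℝ | (a, w) ∈ {ω : (Fin N → Fin M → ℝ) × (Fin M → ℝ) |
        ω.2 ⬝ᵥ ω.2 ≤ R} ∩ {ω | t ≤ |(∑ j ∈ U, ω.1 j) ⬝ᵥ ω.2|}} = ∅ := by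
      ext a; simp [h]
    rw [this]; simp; positivity

lemma measurableSet_dotProduct_self_ge {M : ℕ} (c : ℝ) :
    MeasurableSet {g : Fin M → ℝ | c ≤ g ⬝ᵥ g} :=
  measurableSet_le measurable_const (measurable_dotProduct measurable_id measurable_id)

lemma measurableSet_dotProduct_self_le {M : ℕ} (c : ℝ) :
    MeasurableSet {g : Fin M → ℝ | g ⬝ᵥ g ≤ c} :=
  measurableSet_le (measurable_dotProduct measurable_id measurable_id) measurable_const

lemma law_residual_norm_tail {N M : ℕ} (v : ℝ≥0) (U : Finset (Fin N)) {s₀ δ : ℝ}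
    (hs₀ : 0 < s₀) (hs : (U.card : ℝ) / M + v ≤ s₀) (hδ : 0 < δ) (hδ1 : δ ≤ 1) :
    (law N M v).real {ω | (1 + δ) * (M * s₀) ≤
      (∑ j ∈ U, ω.1 j + ω.2) ⬝ᵥ (∑ j ∈ U, ω.1 j + ω.2)} ≤ Real.exp (-(δ ^ 2 / 16) * M) := by
  have h := gaussianVec_upper_tail (M := M) (s := U.card * (M : ℝ≥0)⁻¹ + v) hs₀
    (by push_cast; rwa [← div_eq_mul_inv]) hδ hδ1
  rwa [← map_sum_columns_add_noise, map_measureReal_apply (by fun_prop)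
    (measurableSet_dotProduct_self_ge _)] at h

lemma law_sum_norm_upper_tail {N M : ℕ} (hM : 0 < M) (v : ℝ≥0) {U : Finset (Fin N)}
    (hU : U.Nonempty) {δ : ℝ} (hδ : 0 < δ) (hδ1 : δ ≤ 1) :
    (law N M v).real {ω | (1 + δ) * U.card ≤ (∑ j ∈ U, ω.1 j) ⬝ᵥ (∑ j ∈ U, ω.1 j)} ≤
      Real.exp (-(δ ^ 2 / 16) * M) := by
  have hM' : (0 : ℝ) < M := by exact_mod_cast hM
  have hU' : (0 : ℝ) < U.card := by exact_mod_cast hU.card_pos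
  have h := gaussianVec_upper_tail (M := M) (s := U.card * (M : ℝ≥0)⁻¹) (s₀ := U.card / M)
    (by positivity) (by push_cast; rw [← div_eq_mul_inv]) hδ hδ1
  rw [← map_sum_columns, ← map_fst_law N M v, Measure.map_map (by fun_prop) (by fun_prop),
    map_measureReal_apply (by fun_prop) (measurableSet_dotProduct_self_ge _)] at h
  have e : (M : ℝ) * (U.card / M) = U.card := by field_simp
  rwa [e] at h

lemma law_sum_norm_lower_tail {N M : ℕ} (hM : 0 < M) (v : ℝ≥0) {U : Finset (Fin N)}
    (hU : U.Nonempty) {δ : ℝ} (hδ : 0 < δ) :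
    (law N M v).real {ω | (∑ j ∈ U, ω.1 j) ⬝ᵥ (∑ j ∈ U, ω.1 j) ≤ (1 - δ) * U.card} ≤
      Real.exp (-(δ ^ 2 / 16) * M) := by
  have hM' : (0 : ℝ) < M := by exact_mod_cast hM
  have h := gaussianVec_lower_tail (M := M) (s := U.card * (M : ℝ≥0)⁻¹)
    (by simp [hU.ne_empty]; omega) hδ
  rw [← map_sum_columns, ← map_fst_law N M v, Measure.map_map (by fun_prop) (by fun_prop),
    map_measureReal_apply (by fun_prop) (measurableSet_dotProduct_self_le _)] at h
  have e : (M : ℝ) * ((U.card * (M : ℝ≥0)⁻¹ : ℝ≥0) : ℝ) = U.card := by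
    push_cast; field_simp
  rwa [e] at h

/-! ### The oracle confined to the true support -/

/-- The residual when exactly the columns in `U` are still to be found. -/
def residualOn {N M : ℕ} (a : Fin N → Fin M → ℝ) (w : Fin M → ℝ) (U : Finset (Fin N)) :
    Fin M → ℝ :=
  ∑ j ∈ U, a j + w

/-- The maximizers of the log-MAP ratio among the unselected indices of the true support `T`. -/
noncomputable def oracleMaximizers {N M : ℕ} (T : Finset (Fin N)) (K : ℕ) (v : ℝ≥0)
    (a : Fin N → Fin M → ℝ) (w : Fin M → ℝ) (k : ℕ) (S : Finset (Fin N)) : Finset (Fin N) :=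
  open Classical in
  (T \ S).filter fun n => ∀ j ∈ T \ S,
    mapRatio N K M v k (corr (a j) (residualOn a w (T \ S))) ≤
      mapRatio N K M v k (corr (a n) (residualOn a w (T \ S)))

/-- MAP-MP with its choices restricted to the true support `T`. -/
noncomputable def oracle {N M : ℕ} (T : Finset (Fin N)) (c : Finset (Fin N) → Fin N) (K : ℕ)
    (v : ℝ≥0) (a : Fin N → Fin M → ℝ) (w : Fin M → ℝ) : ℕ → Finset (Fin N)
  | 0 => ∅
  | k + 1 =>
      insert (c (oracleMaximizers T K v a w (k + 1) (oracle T c K v a w k)))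
        (oracle T c K v a w k)

section
variable {N M : ℕ} {T : Finset (Fin N)} {c : Finset (Fin N) → Fin N} {K : ℕ} {v : ℝ≥0}

lemma oracleMaximizers_subset (a : Fin N → Fin M → ℝ) (w : Fin M → ℝ) (k : ℕ)
    (S : Finset (Fin N)) : oracleMaximizers T K v a w k S ⊆ T \ S :=
  Finset.filter_subset _ _

lemma oracleMaximizers_nonempty (a : Fin N → Fin M → ℝ) (w : Fin M → ℝ) (k : ℕ)
    {S : Finset (Fin N)} (h : (T \ S).Nonempty) : (oracleMaximizers T K v a w k S).Nonempty := by
  obtain ⟨n, hn, hmax⟩ := Finset.exists_max_image (T \ S)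
    (fun j => mapRatio N K M v k (corr (a j) (residualOn a w (T \ S)))) h
  exact ⟨n, by classical exact Finset.mem_filter.2 ⟨hn, hmax⟩⟩

lemma oracle_subset_card (hc : ∀ A : Finset (Fin N), A.Nonempty → c A ∈ A) (hT : T.card = K)
    (a : Fin N → Fin M → ℝ) (w : Fin M → ℝ) :
    ∀ k ≤ K, oracle T c K v a w k ⊆ T ∧ (oracle T c K v a w k).card = k := by
  intro k
  induction k with
  | zero => simp [oracle]
  | succ k ih =>
    intro hk
    obtain ⟨h1, h2⟩ := ih (by omega)
    have hne : (T \ oracle T c K v a w k).Nonempty := by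
      rw [← Finset.card_pos, Finset.card_sdiff_of_subset h1]; omega
    have hmem := oracleMaximizers_subset a w (k + 1) _
      (hc _ (oracleMaximizers_nonempty (K := K) (v := v) a w (k + 1) hne))
    rw [Finset.mem_sdiff] at hmem
    rw [oracle]
    exact ⟨Finset.insert_subset hmem.1 h1, by rw [Finset.card_insert_of_notMem hmem.2, h2]⟩

lemma residualOn_congr {a a' : Fin N → Fin M → ℝ} {U : Finset (Fin N)} (w : Fin M → ℝ)
    (h : ∀ j ∈ U, a j = a' j) : residualOn a w U = residualOn a' w U := by
  rw [residualOn, residualOn, Finset.sum_congr rfl h]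

/-- Both the candidates and the residual involve only columns in `T`. This is the source of the
independence between the oracle path and the columns off `T`. -/
lemma oracle_congr {a a' : Fin N → Fin M → ℝ} (w : Fin M → ℝ) (h : ∀ j ∈ T, a j = a' j) (k : ℕ) :
    oracle T c K v a w k = oracle T c K v a' w k := by
  induction k with
  | zero => rfl
  | succ k ih =>
    have hm : ∀ S, oracleMaximizers T K v a w (k + 1) S = oracleMaximizers T K v a' w (k + 1) S := by
      intro S
      have hr : residualOn a w (T \ S) = residualOn a' w (T \ S) :=
        residualOn_congr w fun j hj => h j (Finset.sdiff_subset hj)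
      rw [oracleMaximizers, oracleMaximizers, hr]
      refine Finset.filter_congr fun n hn => forall₂_congr fun j hj => ?_
      rw [h j (Finset.sdiff_subset hj), h n (Finset.sdiff_subset hn)]
    rw [oracle, oracle, ih, hm]

lemma measurable_mapRatio (k : ℕ) : Measurable (mapRatio N K M v k) := by
  unfold mapRatio
  split_ifs <;> fun_prop

lemma measurable_corr {Ω : Type*} [MeasurableSpace Ω] {f g : Ω → Fin M → ℝ}
    (hf : Measurable f) (hg : Measurable g) : Measurable fun ω => corr (f ω) (g ω) :=
  (measurable_dotProduct hf hg).div (measurable_dotProduct hf hf).sqrt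

lemma measurable_residualOn (U : Finset (Fin N)) :
    Measurable fun ω : (Fin N → Fin M → ℝ) × (Fin M → ℝ) => residualOn ω.1 ω.2 U := by
  unfold residualOn; fun_prop

/-- Splits an event over the finitely many values of a random set; the tie-breaking rule then needs
no regularity. -/
lemma measurableSet_mem_fiber {Ω α : Type*} [MeasurableSpace Ω] [Finite α] {f : Ω → α}
    (hf : ∀ s, MeasurableSet {ω | f ω = s}) {p : α → Set Ω} (hp : ∀ s, MeasurableSet (p s)) :
    MeasurableSet {ω | ω ∈ p (f ω)} := by
  have : {ω | ω ∈ p (f ω)} = ⋃ s, {ω | f ω = s} ∩ p s := by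
    ext ω; simp
  rw [this]
  exact MeasurableSet.iUnion fun s => (hf s).inter (hp s)

lemma measurableSet_oracleMaximizers_eq (k : ℕ) (S A : Finset (Fin N)) :
    MeasurableSet {ω : (Fin N → Fin M → ℝ) × (Fin M → ℝ) |
      oracleMaximizers T K v ω.1 ω.2 k S = A} := by
  have hΛ : ∀ n, Measurable fun ω : (Fin N → Fin M → ℝ) × (Fin M → ℝ) =>
      mapRatio N K M v k (corr (ω.1 n) (residualOn ω.1 ω.2 (T \ S))) := fun n =>
    (measurable_mapRatio k).comp (measurable_corr (by fun_prop) (measurable_residualOn _))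
  have : {ω : (Fin N → Fin M → ℝ) × (Fin M → ℝ) | oracleMaximizers T K v ω.1 ω.2 k S = A} =
      ⋂ n, {ω | (n ∈ T \ S ∧ ∀ j, j ∈ T \ S →
        mapRatio N K M v k (corr (ω.1 j) (residualOn ω.1 ω.2 (T \ S))) ≤
        mapRatio N K M v k (corr (ω.1 n) (residualOn ω.1 ω.2 (T \ S)))) ↔ n ∈ A} := by
    ext ω
    simp only [oracleMaximizers, Finset.ext_iff, Finset.mem_filter, Set.mem_ofPred_eq,
      Set.mem_iInter]
  rw [this]
  refine MeasurableSet.iInter fun n => ?_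
  refine measurableSet_setOfPred.2 (Measurable.iff ?_ measurable_const)
  refine measurableSet_setOfPred.1 ((MeasurableSet.const _).inter ?_)
  have e : {ω : (Fin N → Fin M → ℝ) × (Fin M → ℝ) | ∀ j, j ∈ T \ S →
        mapRatio N K M v k (corr (ω.1 j) (residualOn ω.1 ω.2 (T \ S))) ≤
        mapRatio N K M v k (corr (ω.1 n) (residualOn ω.1 ω.2 (T \ S)))} =
      ⋂ j, ⋂ (_ : j ∈ T \ S), {ω |
        mapRatio N K M v k (corr (ω.1 j) (residualOn ω.1 ω.2 (T \ S))) ≤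
        mapRatio N K M v k (corr (ω.1 n) (residualOn ω.1 ω.2 (T \ S)))} := by
    ext ω; simp
  change MeasurableSet {ω : (Fin N → Fin M → ℝ) × (Fin M → ℝ) | ∀ j, j ∈ T \ S →
        mapRatio N K M v k (corr (ω.1 j) (residualOn ω.1 ω.2 (T \ S))) ≤
        mapRatio N K M v k (corr (ω.1 n) (residualOn ω.1 ω.2 (T \ S)))}
  rw [e]
  exact MeasurableSet.iInter fun j => MeasurableSet.iInter fun _ =>
    measurableSet_le (hΛ j) (hΛ n)

lemma measurableSet_oracle_eq (k : ℕ) (S : Finset (Fin N)) :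
    MeasurableSet {ω : (Fin N → Fin M → ℝ) × (Fin M → ℝ) | oracle T c K v ω.1 ω.2 k = S} := by
  induction k generalizing S with
  | zero => exact MeasurableSet.const (∅ = S)
  | succ k ih =>
    refine measurableSet_mem_fiber
      (p := fun S' => {ω | insert (c (oracleMaximizers T K v ω.1 ω.2 (k + 1) S')) S' = S}) ih
      fun S' => ?_
    exact measurableSet_mem_fiber (p := fun A => {_ω | insert (c A) S' = S})
      (measurableSet_oracleMaximizers_eq (k + 1) S') fun A => MeasurableSet.const _

lemma residual_measurement_estimate (a : Fin N → Fin M → ℝ) (w : Fin M → ℝ)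
    {S : Finset (Fin N)} (hS : S ⊆ T) :
    residual a (measurement (estimate T) a w) S = residualOn a w (T \ S) := by
  have h : ∀ A : Finset (Fin N), ∑ n, estimate A n • a n = ∑ n ∈ A, a n := by
    intro A
    simp [estimate, Finset.sum_ite_mem]
  rw [residual, measurement, h, h, residualOn, ← Finset.sum_sdiff hS]
  abel

lemma IsBinarySparse.exists_support {x : Fin N → ℝ} (hx : IsBinarySparse K x) :
    ∃ T : Finset (Fin N), T.card = K ∧ x = estimate T := by
  classical
  refine ⟨Finset.univ.filter fun n => x n ≠ 0, ?_, ?_⟩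
  · rw [← hx.2, ← Set.ncard_coe_finset]; simp
  · ext n
    rcases hx.1 n with h | h <;> simp [estimate, h]

/-- If in every iteration some remaining support index beats all indices off the support, then
MAP-MP coincides with the oracle. -/
lemma support_eq_oracle (hc : ∀ A : Finset (Fin N), A.Nonempty → c A ∈ A) (hT : T.card = K)
    (a : Fin N → Fin M → ℝ) (w : Fin M → ℝ)
    (hwin : ∀ k < K, ∃ j ∈ T \ oracle T c K v a w k, ∀ n ∉ T,
      mapRatio N K M v (k + 1) (corr (a n) (residualOn a w (T \ oracle T c K v a w k))) <
        mapRatio N K M v (k + 1) (corr (a j) (residualOn a w (T \ oracle T c K v a w k)))) :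
    ∀ k ≤ K, support c K v a (measurement (estimate T) a w) k = oracle T c K v a w k := by
  intro k
  induction k with
  | zero => intro _; rfl
  | succ k ih =>
    intro hk
    have hsub := (oracle_subset_card (v := v) hc hT a w k (by omega)).1
    rw [support, oracle, ih (by omega)]
    -- The tie-breaking rule sees only the set of maximizers, so equality of the two sets forces the
    -- same choice.
    congr 2
    set S := oracle T c K v a w k
    obtain ⟨j, hj, hj'⟩ := hwin k (by omega)
    rw [maximizers, oracleMaximizers, residual_measurement_estimate a w hsub]
    ext n
    simp only [Finset.mem_filter, Finset.mem_compl]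
    rw [Finset.mem_sdiff] at hj
    constructor
    · rintro ⟨h1, h2⟩
      have hn : n ∈ T := by
        by_contra hn
        exact absurd (h2 j hj.2) (not_le.2 (hj' n hn))
      exact ⟨Finset.mem_sdiff.2 ⟨hn, h1⟩, fun i hi => h2 i (Finset.mem_sdiff.1 hi).2⟩
    · rintro ⟨h1, h2⟩
      refine ⟨(Finset.mem_sdiff.1 h1).2, fun i hi => ?_⟩
      by_cases hiT : i ∈ T
      · exact h2 i (Finset.mem_sdiff.2 ⟨hiT, hi⟩)
      · exact (hj' i hiT).le.trans (h2 j (Finset.mem_sdiff.2 hj))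

end

/-! ### Deterministic comparison of log-MAP ratios -/

/-- In the regular case Λ is a concave parabola in z with vertex K - k + Mv, so the smaller argument
loses as soon as the midpoint lies left of the vertex. In the noise-free last iteration Λ increases
with z², which is why `h1` bounds |z|. -/
lemma mapRatio_lt_mapRatio {N K M : ℕ} {v : ℝ≥0} {k : ℕ} (hM : 0 < M) (hk : k < K) {z z' : ℝ}
    (h1 : |z| < z') (h2 : z + z' < 2 * ((K : ℝ) - k + M * v)) :
    mapRatio N K M v (k + 1) z < mapRatio N K M v (k + 1) z' := by
  have hM' : (0 : ℝ) < M := by exact_mod_cast hM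
  have hv : (0 : ℝ) ≤ v := v.2
  unfold mapRatio
  split_ifs with h
  · have : z ^ 2 < z' ^ 2 := sq_lt_sq' (by linarith [neg_abs_le z]) (by linarith [le_abs_self z])
    have := mul_lt_mul_of_pos_left this hM'
    linarith
  · have hk' : (k : ℝ) + 1 ≤ K := by exact_mod_cast hk
    -- This denominator vanishes only for v = 0 in the last iteration, the case already split off.
    have hβ : 0 < ((K : ℝ) - (k + 1 : ℕ)) / M + v := by
      push_cast
      by_cases hv0 : v = 0
      · have : k + 1 < K := lt_of_le_of_ne hk fun e => h ⟨hv0, e⟩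
        have : (k : ℝ) + 1 < K := by exact_mod_cast this
        have : 0 < ((K : ℝ) - (k + 1)) / M := div_pos (by linarith) hM'
        linarith
      · have : 0 < (v : ℝ) := by exact_mod_cast pos_iff_ne_zero.2 hv0
        have : 0 ≤ ((K : ℝ) - (k + 1)) / M := div_nonneg (by linarith) hM'.le
        linarith
    set β : ℝ := ((K : ℝ) - (k + 1 : ℕ)) / M + v with hβd
    have hα : ((K : ℝ) - (k + 1 : ℕ) + 1) / M + v = β + 1 / M := by rw [hβd]; ring
    have h2' : z + z' < 2 * M * (β + 1 / M) := by
      have : M * (β + 1 / M) = (K : ℝ) - k + M * v := by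
        rw [hβd]; push_cast; field_simp; ring
      linarith
    rw [hα]
    have key : z ^ 2 / (2 * (β + 1 / M)) - (z - 1) ^ 2 / (2 * β) <
        z' ^ 2 / (2 * (β + 1 / M)) - (z' - 1) ^ 2 / (2 * β) := by
      rw [← sub_pos]
      have hα0 : 0 < β + 1 / M := by positivity
      have e : z' ^ 2 / (2 * (β + 1 / M)) - (z' - 1) ^ 2 / (2 * β) -
          (z ^ 2 / (2 * (β + 1 / M)) - (z - 1) ^ 2 / (2 * β)) =
          (z' - z) * (2 * M * (β + 1 / M) - (z + z')) / (2 * M * β * (β + 1 / M)) := by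
        have : β * M + 1 ≠ 0 := by positivity
        field_simp
        ring
      rw [e]
      refine div_pos (mul_pos ?_ (by linarith)) (by positivity)
      linarith [le_abs_self z]
    linarith

lemma dotProduct_self_nonneg {M : ℕ} (a : Fin M → ℝ) : 0 ≤ a ⬝ᵥ a := by
  rw [dotProduct_self_eq_sum]; positivity

lemma dotProduct_sq_le {M : ℕ} (a r : Fin M → ℝ) : (a ⬝ᵥ r) ^ 2 ≤ (a ⬝ᵥ a) * (r ⬝ᵥ r) := by
  rw [dotProduct_self_eq_sum, dotProduct_self_eq_sum]
  exact Finset.sum_mul_sq_le_sq_mul_sq _ _ _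

lemma corr_le_sqrt {M : ℕ} (a r : Fin M → ℝ) : corr a r ≤ √(r ⬝ᵥ r) := by
  have h : a ⬝ᵥ r ≤ √(a ⬝ᵥ a) * √(r ⬝ᵥ r) := by
    rw [← Real.sqrt_mul (dotProduct_self_nonneg a)]
    exact Real.le_sqrt_of_sq_le (dotProduct_sq_le a r)
  exact div_le_of_le_mul₀ (Real.sqrt_nonneg _) (Real.sqrt_nonneg _) (by rwa [mul_comm])

/-- If the correlations off the support are small, some remaining support index wins. -/
lemma exists_winner {N M : ℕ} {T U : Finset (Fin N)} {a : Fin N → Fin M → ℝ} {w : Fin M → ℝ}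
    {δ κ ρ V : ℝ} (hδ : 0 < δ) (hδ1 : δ ≤ 1 / 25) (hV : 0 ≤ V) (hκ : κ ≤ 1 - δ)
    (hρκ : ρ * (1 + δ) < (1 - δ - κ) * (1 - δ)) (hρ : ρ ≤ 9 / 10 * (1 - δ))
    (hU : U.Nonempty)
    (hA : (1 - δ) * U.card ≤ (∑ j ∈ U, a j) ⬝ᵥ (∑ j ∈ U, a j))
    (hAw : -(κ * U.card) ≤ (∑ j ∈ U, a j) ⬝ᵥ w)
    (hr : residualOn a w U ⬝ᵥ residualOn a w U ≤ (1 + δ) * (U.card + V))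
    (hlo : ∀ n, 1 - δ ≤ a n ⬝ᵥ a n) (hup : ∀ n, a n ⬝ᵥ a n ≤ 1 + δ)
    (hoff : ∀ n ∉ T, |a n ⬝ᵥ residualOn a w U| ≤ ρ) :
    ∃ j ∈ U, ∀ n ∉ T, |corr (a n) (residualOn a w U)| < corr (a j) (residualOn a w U) ∧
      corr (a n) (residualOn a w U) + corr (a j) (residualOn a w U) < 2 * (U.card + V) := by
  set r := residualOn a w U with hrd
  have hsum : ∑ j ∈ U, (1 - δ - κ) ≤ ∑ j ∈ U, a j ⬝ᵥ r := by
    rw [← sum_dotProduct, Finset.sum_const, nsmul_eq_mul]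
    have : (∑ j ∈ U, a j) ⬝ᵥ r = (∑ j ∈ U, a j) ⬝ᵥ (∑ j ∈ U, a j) + (∑ j ∈ U, a j) ⬝ᵥ w := by
      rw [hrd, residualOn, dotProduct_add]
    rw [this]
    linarith
  -- Some index attains at least the average correlation over U.
  obtain ⟨j, hj, hj'⟩ := Finset.exists_le_of_sum_le hU hsum
  refine ⟨j, hj, fun n hn => ?_⟩
  have hm : (1 : ℝ) ≤ U.card := by exact_mod_cast hU.card_pos
  have hsup : √(a j ⬝ᵥ a j) ≤ 1 + δ :=
    Real.sqrt_le_iff.2 ⟨by linarith, (hup j).trans (by nlinarith)⟩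
  have hspos : 0 < √(a j ⬝ᵥ a j) := Real.sqrt_pos.2 (by linarith [hlo j])
  have hzj : (1 - δ - κ) / (1 + δ) ≤ corr (a j) r := by
    rw [corr]
    exact div_le_div₀ (by linarith) hj' hspos hsup
  have hslo : 1 - δ ≤ √(a n ⬝ᵥ a n) :=
    Real.le_sqrt_of_sq_le (by nlinarith [hlo n])
  have hρ0 : 0 ≤ ρ := (abs_nonneg _).trans (hoff n hn)
  have hzn : |corr (a n) r| ≤ ρ / (1 - δ) := by
    rw [corr, abs_div, abs_of_nonneg (Real.sqrt_nonneg _)]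
    exact div_le_div₀ hρ0 (hoff n hn) (by linarith) hslo
  have hzr := corr_le_sqrt (a j) r
  constructor
  · refine (hzn.trans_lt ?_).trans_le hzj
    rwa [div_lt_div_iff₀ (by linarith) (by linarith)]
  · have h1 : ρ / (1 - δ) ≤ 9 / 10 := by rwa [div_le_iff₀ (by linarith)]
    -- AM-GM on (1 + δ)(|U| + V). With |U| ≥ 1 and δ ≤ 1/25, the sum of both correlations is at most
    -- 0.9 + 0.52 + (|U| + V)/2 < 2(|U| + V).
    have h2 : √(r ⬝ᵥ r) ≤ ((1 + δ) + (U.card + V)) / 2 := by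
      refine Real.sqrt_le_iff.2 ⟨by linarith, hr.trans ?_⟩
      nlinarith [sq_nonneg ((1 + δ) - (U.card + V))]
    linarith [le_abs_self (corr (a n) r)]

/-! ### Union bounds and the non-asymptotic failure probability -/

lemma measureReal_exists_mem_le {Ω ι : Type*} [MeasurableSpace Ω] {μ : Measure Ω}
    [IsFiniteMeasure μ] (s : Finset ι) (P : ι → Ω → Prop) {p : ℝ}
    (h : ∀ i ∈ s, μ.real {ω | P i ω} ≤ p) : μ.real {ω | ∃ i ∈ s, P i ω} ≤ s.card * p := by
  have e : {ω | ∃ i ∈ s, P i ω} = ⋃ i ∈ s, {ω | P i ω} := by ext; simp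
  rw [e]
  calc _ ≤ ∑ i ∈ s, μ.real {ω | P i ω} := measureReal_biUnion_finset_le _ _
    _ ≤ ∑ _i ∈ s, p := Finset.sum_le_sum h
    _ = s.card * p := by simp

section
variable {N M : ℕ} {T : Finset (Fin N)} {c : Finset (Fin N) → Fin N} {K : ℕ} {v : ℝ≥0}

lemma oracle_update {n : Fin N} (hn : n ∉ T) (a : Fin N → Fin M → ℝ) (b w : Fin M → ℝ) (k : ℕ) :
    oracle T c K v (Function.update a n b) w k = oracle T c K v a w k :=
  oracle_congr w (fun j hj => Function.update_of_ne (by rintro rfl; exact hn hj) _ _) k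

/-- A column off the support is nearly orthogonal to any combination of the remaining columns
and the noise. -/
lemma law_off_support_tail (hM : 0 < M) {n : Fin N} (hn : n ∉ T) (k : ℕ)
    (G : Finset (Fin N) → (Fin N → Fin M → ℝ) × (Fin M → ℝ) → Fin M → ℝ)
    (hG : ∀ U, Measurable (G U))
    (hGcongr : ∀ U ⊆ T, ∀ a w b, G U (Function.update a n b, w) = G U (a, w))
    {R t : ℝ} (hR : 0 < R) (ht : 0 ≤ t) :
    (law N M v).real {ω | G (T \ oracle T c K v ω.1 ω.2 k) ω ⬝ᵥ
        G (T \ oracle T c K v ω.1 ω.2 k) ω ≤ R ∧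
        t ≤ |ω.1 n ⬝ᵥ G (T \ oracle T c K v ω.1 ω.2 k) ω|} ≤
      2 * Real.exp (-(t ^ 2 * M / (2 * R))) := by
  refine law_column_dotProduct_tail hM v n (fun a w => G (T \ oracle T c K v a w k) (a, w))
    (fun a w b => ?_) hR ht ?_
  · simp only [oracle_update hn]
    exact hGcongr _ Finset.sdiff_subset a w b
  · refine measurableSet_mem_fiber (f := fun ω => oracle T c K v ω.1 ω.2 k)
      (p := fun S => {ω | G (T \ S) ω ⬝ᵥ G (T \ S) ω ≤ R ∧ t ≤ |ω.1 n ⬝ᵥ G (T \ S) ω|})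
      (measurableSet_oracle_eq k) fun S => ?_
    exact (measurableSet_le (measurable_dotProduct (hG _) (hG _)) measurable_const).inter
      (measurableSet_le measurable_const (measurable_dotProduct (by fun_prop) (hG _)).abs)

lemma sum_update_of_notMem {n : Fin N} (hn : n ∉ T) {U : Finset (Fin N)} (hU : U ⊆ T)
    (a : Fin N → Fin M → ℝ) (b : Fin M → ℝ) :
    ∑ j ∈ U, Function.update a n b j = ∑ j ∈ U, a j :=
  Finset.sum_congr rfl fun j hj => Function.update_of_ne (by rintro rfl; exact hn (hU hj)) _ _

/-- The conditions on the columns and the noise under which MAP-MP succeeds. -/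
lemma support_eq_of_bounds (hM : 0 < M) (hc : ∀ A : Finset (Fin N), A.Nonempty → c A ∈ A)
    (hT : T.card = K) {δ θ η m₀ : ℝ} (hδ : 0 < δ) (hδ1 : δ ≤ 1 / 25) (hθ : θ + η ≤ 1 / 2)
    (hθη : (θ + η) * (1 + δ) < (1 - δ - θ) * (1 - δ)) (hη : 0 ≤ η)
    {a : Fin N → Fin M → ℝ} {w : Fin M → ℝ}
    (hA : ∀ U ⊆ T, U.Nonempty → (1 - δ) * U.card ≤ (∑ j ∈ U, a j) ⬝ᵥ (∑ j ∈ U, a j))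
    (hr : ∀ U ⊆ T, U.Nonempty →
      residualOn a w U ⬝ᵥ residualOn a w U ≤ (1 + δ) * (U.card + M * v))
    (hlo : ∀ n, 1 - δ ≤ a n ⬝ᵥ a n) (hup : ∀ n, a n ⬝ᵥ a n ≤ 1 + δ)
    (hAw : ∀ U ⊆ T, U.Nonempty → m₀ ≤ U.card → |(∑ j ∈ U, a j) ⬝ᵥ w| ≤ δ * U.card)
    (hw : ∀ n, |a n ⬝ᵥ w| ≤ θ)
    (hoff : ∀ k < K, ∀ n ∉ T,
      |a n ⬝ᵥ residualOn a w (T \ oracle T c K v a w k)| ≤ 4 / 5)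
    (hoff' : ∀ k < K, (K : ℝ) - k ≤ m₀ → ∀ n ∉ T,
      |a n ⬝ᵥ ∑ j ∈ T \ oracle T c K v a w k, a j| ≤ η) :
    support c K v a (measurement (estimate T) a w) K = T := by
  have horacle := oracle_subset_card (v := v) hc hT a w
  have h : support c K v a (measurement (estimate T) a w) K = oracle T c K v a w K := by
    refine support_eq_oracle hc hT a w (fun k hk => ?_) K le_rfl
    obtain ⟨hsub, hcard⟩ := horacle k hk.le
    set U := T \ oracle T c K v a w k with hUd
    have hUT : U ⊆ T := Finset.sdiff_subset
    have hUc : U.card = K - k := by rw [hUd, Finset.card_sdiff_of_subset hsub, hT, hcard]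
    have hU : U.Nonempty := by rw [← Finset.card_pos, hUc]; omega
    have hUc' : (U.card : ℝ) = (K : ℝ) - k := by rw [hUc, Nat.cast_sub hk.le]
    have hV : (0 : ℝ) ≤ M * v := by positivity
    suffices ∃ j ∈ U, ∀ n ∉ T,
        |corr (a n) (residualOn a w U)| < corr (a j) (residualOn a w U) ∧
        corr (a n) (residualOn a w U) + corr (a j) (residualOn a w U) <
          2 * (U.card + M * v) by
      obtain ⟨j, hj, hj'⟩ := this
      refine ⟨j, hj, fun n hn => mapRatio_lt_mapRatio hM hk (hj' n hn).1 ?_⟩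
      rw [← hUc']
      exact (hj' n hn).2
    -- Many remaining columns: the noise averages out over U. Few remaining columns: noise and
    -- column sum are bounded separately, by θ and η.
    rcases le_total m₀ (U.card : ℝ) with hm | hm
    · exact exists_winner hδ hδ1 hV (κ := δ) (ρ := 4 / 5) (by linarith) (by nlinarith)
        (by linarith) hU (hA U hUT hU) (abs_le.1 (hAw U hUT hU hm)).1 (hr U hUT hU) hlo hup
        (hoff k hk)
    · have hm' : (K : ℝ) - k ≤ m₀ := hUc' ▸ hm
      refine exists_winner hδ hδ1 hV (κ := θ) (ρ := θ + η) (by linarith) hθη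
        (by linarith) hU (hA U hUT hU) ?_ (hr U hUT hU) hlo hup fun n hn => ?_
      · rw [sum_dotProduct]
        have : ∑ j ∈ U, (-θ) ≤ ∑ j ∈ U, a j ⬝ᵥ w :=
          Finset.sum_le_sum fun j _ => (abs_le.1 (hw j)).1
        rw [Finset.sum_const, nsmul_eq_mul] at this
        linarith
      · rw [residualOn, dotProduct_add, add_comm θ η]
        exact (abs_add_le _ _).trans (add_le_add (hoff' k hk hm' n hn) (hw n))
  rw [h]
  exact Finset.eq_of_subset_of_card_le (horacle K le_rfl).1 (by rw [(horacle K le_rfl).2, hT])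

/-- A non-asymptotic bound for the failure probability of MAP-MP. -/
lemma one_sub_successProb_le (hM : 0 < M) (hK : 0 < K)
    (hc : ∀ A : Finset (Fin N), A.Nonempty → c A ∈ A)
    (hT : T.card = K) {δ θ η m₀ R : ℝ} (hδ : 0 < δ) (hδ1 : δ ≤ 1 / 25) (hθ : θ + η ≤ 1 / 2)
    (hθη : (θ + η) * (1 + δ) < (1 - δ - θ) * (1 - δ)) (hη : 0 ≤ η) (hθ0 : 0 ≤ θ) (hm₀ : 0 < m₀)
    (hR : (1 + δ) * (K + M * v) ≤ R) :
    1 - successProb c K M v (estimate T) ≤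
      3 * (2 ^ K * Real.exp (-(δ ^ 2 / 16) * M)) + 2 * (N * Real.exp (-(δ ^ 2 / 16) * M)) +
      Real.exp (-(δ ^ 2 / 16) * M) +
      2 ^ K * (2 * Real.exp (-(δ ^ 2 * m₀ * M / (2 * R)))) +
      N * (2 * Real.exp (-(θ ^ 2 * M / (2 * R)))) +
      K * (N * (2 * Real.exp (-((4 / 5) ^ 2 * M / (2 * R))))) +
      K * (N * (2 * Real.exp (-(η ^ 2 * M / (2 * ((1 + δ) * m₀)))))) := by
  classical
  have hM' : (0 : ℝ) < M := by exact_mod_cast hM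
  have hK' : (0 : ℝ) < K := by exact_mod_cast hK
  have hv : (0 : ℝ) ≤ v := v.2
  have hR0 : 0 < R := lt_of_lt_of_le (by positivity) hR
  have hcardT : ∀ U ⊆ T, (U.card : ℝ) ≤ K := fun U hU => by
    exact_mod_cast hT ▸ Finset.card_le_card hU
  set E := Real.exp (-(δ ^ 2 / 16) * M) with hE
  have hE0 : 0 < E := Real.exp_pos _
  set μ := law N M v with hμ
  -- The remaining set depends on the very columns it indexes, so norm bounds are needed for every
  -- nonempty subset of `T`, at the price of a factor 2^K.
  set Us : Finset (Finset (Fin N)) := T.powerset.filter fun U => U.Nonempty with hUs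
  have hUs_mem : ∀ U, U ∈ Us ↔ U ⊆ T ∧ U.Nonempty := fun U => by simp [hUs]
  have hUs_card : (Us.card : ℝ) ≤ 2 ^ K := by
    have : Us.card ≤ 2 ^ K := by
      rw [← hT, ← Finset.card_powerset]; exact Finset.card_filter_le _ _
    exact_mod_cast this
  have hcompl : ((Finset.univ.filter fun n => n ∉ T).card : ℝ) ≤ N := by
    have := Finset.card_filter_le (Finset.univ : Finset (Fin N)) (fun n => n ∉ T)
    rw [Finset.card_univ, Fintype.card_fin] at this
    exact_mod_cast this
  let B1 : Set ((Fin N → Fin M → ℝ) × (Fin M → ℝ)) :=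
    {ω | ∃ U ∈ Us, (∑ j ∈ U, ω.1 j) ⬝ᵥ (∑ j ∈ U, ω.1 j) ≤ (1 - δ) * U.card}
  let B2 : Set ((Fin N → Fin M → ℝ) × (Fin M → ℝ)) :=
    {ω | ∃ U ∈ Us, (1 + δ) * (M * ((U.card : ℝ) / M + v)) ≤
      (∑ j ∈ U, ω.1 j + ω.2) ⬝ᵥ (∑ j ∈ U, ω.1 j + ω.2)}
  let B3 : Set ((Fin N → Fin M → ℝ) × (Fin M → ℝ)) :=
    {ω | ∃ U ∈ Us, (1 + δ) * U.card ≤ (∑ j ∈ U, ω.1 j) ⬝ᵥ (∑ j ∈ U, ω.1 j)}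
  let B4 : Set ((Fin N → Fin M → ℝ) × (Fin M → ℝ)) :=
    {ω | ∃ n ∈ (Finset.univ : Finset (Fin N)),
      (∑ j ∈ {n}, ω.1 j) ⬝ᵥ (∑ j ∈ {n}, ω.1 j) ≤ (1 - δ) * ({n} : Finset (Fin N)).card}
  let B5 : Set ((Fin N → Fin M → ℝ) × (Fin M → ℝ)) :=
    {ω | ∃ n ∈ (Finset.univ : Finset (Fin N)),
      (1 + δ) * ({n} : Finset (Fin N)).card ≤ (∑ j ∈ {n}, ω.1 j) ⬝ᵥ (∑ j ∈ {n}, ω.1 j)}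
  let B6 : Set ((Fin N → Fin M → ℝ) × (Fin M → ℝ)) :=
    {ω | (1 + δ) * (M * ((K : ℝ) / M + v)) ≤
      (∑ j ∈ (∅ : Finset (Fin N)), ω.1 j + ω.2) ⬝ᵥ (∑ j ∈ (∅ : Finset (Fin N)), ω.1 j + ω.2)}
  let B7 : Set ((Fin N → Fin M → ℝ) × (Fin M → ℝ)) :=
    {ω | ∃ U ∈ Us.filter fun U => m₀ ≤ U.card,
      ω.2 ⬝ᵥ ω.2 ≤ R ∧ δ * U.card ≤ |(∑ j ∈ U, ω.1 j) ⬝ᵥ ω.2|}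
  let B8 : Set ((Fin N → Fin M → ℝ) × (Fin M → ℝ)) :=
    {ω | ∃ n ∈ (Finset.univ : Finset (Fin N)),
      ω.2 ⬝ᵥ ω.2 ≤ R ∧ θ ≤ |(∑ j ∈ {n}, ω.1 j) ⬝ᵥ ω.2|}
  -- Here and in `B10` no union over subsets is needed: the oracle's remaining set is independent of
  -- column n, so K · N events suffice.
  let B9 : Set ((Fin N → Fin M → ℝ) × (Fin M → ℝ)) :=
    {ω | ∃ k ∈ Finset.range K, ∃ n ∈ Finset.univ.filter fun n => n ∉ T,
      residualOn ω.1 ω.2 (T \ oracle T c K v ω.1 ω.2 k) ⬝ᵥ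
        residualOn ω.1 ω.2 (T \ oracle T c K v ω.1 ω.2 k) ≤ R ∧
      4 / 5 ≤ |ω.1 n ⬝ᵥ residualOn ω.1 ω.2 (T \ oracle T c K v ω.1 ω.2 k)|}
  let B10 : Set ((Fin N → Fin M → ℝ) × (Fin M → ℝ)) :=
    {ω | ∃ k ∈ Finset.range K, ∃ n ∈ Finset.univ.filter fun n => n ∉ T,
      (∑ j ∈ T \ oracle T c K v ω.1 ω.2 k, ω.1 j) ⬝ᵥ
        (∑ j ∈ T \ oracle T c K v ω.1 ω.2 k, ω.1 j) ≤ (1 + δ) * m₀ ∧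
      η ≤ |ω.1 n ⬝ᵥ ∑ j ∈ T \ oracle T c K v ω.1 ω.2 k, ω.1 j|}
  have b1 : μ.real B1 ≤ 2 ^ K * E := by
    refine (measureReal_exists_mem_le Us _ (p := E) fun U hU => ?_).trans (by gcongr)
    exact law_sum_norm_lower_tail hM v ((hUs_mem U).1 hU).2 hδ
  have b2 : μ.real B2 ≤ 2 ^ K * E := by
    refine (measureReal_exists_mem_le Us _ (p := E) fun U hU => ?_).trans (by gcongr)
    have : (0 : ℝ) < U.card := by exact_mod_cast ((hUs_mem U).1 hU).2.card_pos
    exact law_residual_norm_tail v U (by positivity) le_rfl hδ (by linarith)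
  have b3 : μ.real B3 ≤ 2 ^ K * E := by
    refine (measureReal_exists_mem_le Us _ (p := E) fun U hU => ?_).trans (by gcongr)
    exact law_sum_norm_upper_tail hM v ((hUs_mem U).1 hU).2 hδ (by linarith)
  have b4 : μ.real B4 ≤ N * E := by
    refine (measureReal_exists_mem_le Finset.univ _ (p := E) fun n _ => ?_).trans (by simp)
    exact law_sum_norm_lower_tail hM v (Finset.singleton_nonempty n) hδ
  have b5 : μ.real B5 ≤ N * E := by
    refine (measureReal_exists_mem_le Finset.univ _ (p := E) fun n _ => ?_).trans (by simp)
    exact law_sum_norm_upper_tail hM v (Finset.singleton_nonempty n) hδ (by linarith)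
  -- The empty sum leaves the noise alone. Its norm is compared with the level K/M + v, which is
  -- positive even when v = 0.
  have b6 : μ.real B6 ≤ E :=
    law_residual_norm_tail v ∅ (by positivity) (by simp; positivity) hδ (by linarith)
  have b7 : μ.real B7 ≤ 2 ^ K * (2 * Real.exp (-(δ ^ 2 * m₀ * M / (2 * R)))) := by
    refine (measureReal_exists_mem_le _ _
      (p := 2 * Real.exp (-(δ ^ 2 * m₀ * M / (2 * R)))) fun U hU => ?_).trans ?_
    · rw [Finset.mem_filter] at hU
      have hU0 : (0 : ℝ) < U.card := by exact_mod_cast ((hUs_mem U).1 hU.1).2.card_pos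
      refine (law_sum_dotProduct_noise_tail hM v ((hUs_mem U).1 hU.1).2 hR0
        (by positivity)).trans ?_
      have e : (δ * U.card) ^ 2 * M / (2 * U.card * R) = δ ^ 2 * U.card * M / (2 * R) := by
        field_simp
      rw [e]
      have := hU.2
      gcongr
    · gcongr
      exact le_trans (by exact_mod_cast Finset.card_filter_le _ _) hUs_card
  have b8 : μ.real B8 ≤ N * (2 * Real.exp (-(θ ^ 2 * M / (2 * R)))) := by
    refine (measureReal_exists_mem_le Finset.univ _
      (p := 2 * Real.exp (-(θ ^ 2 * M / (2 * R)))) fun n _ => ?_).trans (by simp)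
    have := law_sum_dotProduct_noise_tail hM v (Finset.singleton_nonempty n) hR0 hθ0
    simpa only [Finset.card_singleton, Nat.cast_one, mul_one] using this
  have b9 : μ.real B9 ≤ K * (N * (2 * Real.exp (-((4 / 5) ^ 2 * M / (2 * R))))) := by
    refine (measureReal_exists_mem_le (Finset.range K) _
      (p := N * (2 * Real.exp (-((4 / 5) ^ 2 * M / (2 * R))))) fun k _ => ?_).trans (by simp)
    refine (measureReal_exists_mem_le _ _
      (p := 2 * Real.exp (-((4 / 5) ^ 2 * M / (2 * R)))) fun n hn => ?_).trans (by gcongr)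
    have hn' : n ∉ T := (Finset.mem_filter.1 hn).2
    exact law_off_support_tail hM hn' k (fun U ω => residualOn ω.1 ω.2 U)
      measurable_residualOn (fun U hU a w b => by
        simp only [residualOn, sum_update_of_notMem hn' hU]) hR0 (by norm_num)
  have b10 : μ.real B10 ≤ K * (N * (2 * Real.exp (-(η ^ 2 * M / (2 * ((1 + δ) * m₀)))))) := by
    refine (measureReal_exists_mem_le (Finset.range K) _
      (p := N * (2 * Real.exp (-(η ^ 2 * M / (2 * ((1 + δ) * m₀)))))) fun k _ => ?_).trans
      (by simp)
    refine (measureReal_exists_mem_le _ _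
      (p := 2 * Real.exp (-(η ^ 2 * M / (2 * ((1 + δ) * m₀))))) fun n hn => ?_).trans
      (by gcongr)
    have hn' : n ∉ T := (Finset.mem_filter.1 hn).2
    exact law_off_support_tail hM hn' k (fun U ω => ∑ j ∈ U, ω.1 j)
      (fun U => by fun_prop) (fun U hU a w b => by
        simp only [sum_update_of_notMem hn' hU]) (by positivity) hη
  have hsub : (Set.univ : Set ((Fin N → Fin M → ℝ) × (Fin M → ℝ))) ⊆
      {ω | estimate (support c K v ω.1 (measurement (estimate T) ω.1 ω.2) K) = estimate T} ∪
      (B1 ∪ (B2 ∪ (B3 ∪ (B4 ∪ (B5 ∪ (B6 ∪ (B7 ∪ (B8 ∪ (B9 ∪ B10))))))))) := by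
    rintro ⟨a, w⟩ -
    by_contra hbad
    simp only [Set.mem_union, not_or] at hbad
    obtain ⟨h0, n1, n2, n3, n4, n5, n6, n7, n8, n9, n10⟩ := hbad
    simp only [B1, B2, B3, B4, B5, B6, B7, B8, B9, B10, Set.mem_ofPred_eq, not_exists, not_and,
      not_le, Finset.mem_filter, Finset.mem_range, Finset.mem_univ, true_and,
      Finset.sum_singleton, Finset.card_singleton, Finset.sum_empty, zero_add, Nat.cast_one,
      mul_one, hUs_mem, and_imp] at n1 n2 n3 n4 n5 n6 n7 n8 n9 n10
    have eMv : ∀ m : ℝ, M * (m / M + v) = m + M * v := fun m => by field_simp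
    simp only [eMv] at n2 n6
    have hwR : w ⬝ᵥ w ≤ R := n6.le.trans hR
    refine h0 (congrArg estimate ?_)
    refine support_eq_of_bounds hM hc hT hδ hδ1 hθ hθη hη (m₀ := m₀)
      (fun U h1 h2 => (n1 U h1 h2).le) (fun U h1 h2 => (n2 U h1 h2).le)
      (fun n => (n4 n).le) (fun n => (n5 n).le)
      (fun U h1 h2 h3 => (n7 U h1 h2 h3 hwR).le) (fun n => (n8 n hwR).le)
      (fun k hk n hn => (n9 k hk n hn ?_).le) (fun k hk hkm n hn => (n10 k hk n hn ?_).le)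
    all_goals
      obtain ⟨hsub, hcard⟩ := oracle_subset_card (v := v) hc hT a w k hk.le
      have hUc : (T \ oracle T c K v a w k).card = K - k := by
        rw [Finset.card_sdiff_of_subset hsub, hT, hcard]
      have hU : (T \ oracle T c K v a w k).Nonempty := by
        rw [← Finset.card_pos, hUc]; omega
    · refine ((n2 _ Finset.sdiff_subset hU).le.trans ?_).trans hR
      have := hcardT _ (Finset.sdiff_subset (s := T) (t := oracle T c K v a w k))
      gcongr
    · refine (n3 _ Finset.sdiff_subset hU).le.trans ?_
      rw [hUc, Nat.cast_sub hk.le]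
      gcongr
  have htot : (1 : ℝ) ≤ successProb c K M v (estimate T) +
      (μ.real B1 + (μ.real B2 + (μ.real B3 + (μ.real B4 + (μ.real B5 + (μ.real B6 +
      (μ.real B7 + (μ.real B8 + (μ.real B9 + μ.real B10))))))))) := by
    have h := measureReal_mono (μ := μ) hsub
    rw [probReal_univ] at h
    refine h.trans ?_
    refine (measureReal_union_le _ _).trans (add_le_add le_rfl ?_)
    repeat' refine (measureReal_union_le _ _).trans (add_le_add le_rfl ?_)
    exact le_rfl
  linarith

end

/-! ### Choice of constants and asymptotics -/

/-- The failure bound in terms of the sparsity `k` and of `l = log (N - K)`. -/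
noncomputable def failureBound (δ γ ε k l : ℝ) : ℝ :=
  4 * Real.exp (k * (1 - δ ^ 2 / 2 * l)) + 4 * Real.exp (l * (1 - δ ^ 2 / 2 * k)) +
    2 * Real.exp (k * (1 - 2 * δ ^ 2 * √l)) + 4 * Real.exp (l * (-(ε / 2))) +
    4 * Real.exp (l * (-(2 / 5))) + 4 * Real.exp (l * (2 - 2 * γ ^ 2 * √l))

/-- Every exponent is a quantity tending to infinity times a factor that is eventually negative and
bounded away from 0, so no relation between the growth rates of k and l is needed. -/
lemma tendsto_failureBound {δ γ ε : ℝ} (hδ : 0 < δ) (hγ : 0 < γ) (hε : 0 < ε) {k l : ℕ → ℝ}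
    (hk : Tendsto k atTop atTop) (hl : Tendsto l atTop atTop) :
    Tendsto (fun i => failureBound δ γ ε (k i) (l i)) atTop (𝓝 0) := by
  have aux : ∀ {f g : ℕ → ℝ} (b c : ℝ), 0 < c → Tendsto f atTop atTop → Tendsto g atTop atTop →
      Tendsto (fun i => Real.exp (f i * (b - c * g i))) atTop (𝓝 0) := by
    intro f g b c hc hf hg
    refine Real.tendsto_exp_atBot.comp (hf.atTop_mul_atBot₀ ?_)
    have := (tendsto_neg_atTop_atBot.comp (hg.const_mul_atTop hc))
    simpa [sub_eq_add_neg] using tendsto_atBot_add_const_left atTop b this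
  have hs : Tendsto (fun i => √(l i)) atTop atTop := Real.tendsto_sqrt_atTop.comp hl
  have aux2 : ∀ c : ℝ, 0 < c → Tendsto (fun i => Real.exp (l i * (-c))) atTop (𝓝 0) :=
    fun c hc => Real.tendsto_exp_atBot.comp (hl.atTop_mul_const_of_neg (by linarith))
  have h := (((((aux 1 (δ ^ 2 / 2) (by positivity) hk hl).const_mul 4).add
    ((aux 1 (δ ^ 2 / 2) (by positivity) hl hk).const_mul 4)).add
    ((aux 1 (2 * δ ^ 2) (by positivity) hk hs).const_mul 2)).add
    ((aux2 (ε / 2) (by positivity)).const_mul 4)).add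
    ((aux2 (2 / 5) (by norm_num)).const_mul 4) |>.add
    ((aux 2 (2 * γ ^ 2) (by positivity) hl hs).const_mul 4)
  simpa [failureBound] using h

set_option maxHeartbeats 1000000 in
lemma one_sub_successProb_le_failureBound {N M K : ℕ} {T : Finset (Fin N)}
    {c : Finset (Fin N) → Fin N} {v : ℝ≥0} (hK : 0 < K) (hKN : 2 * K < N)
    (hc : ∀ A : Finset (Fin N), A.Nonempty → c A ∈ A) (hT : T.card = K) {ε : ℝ} (hε : 0 < ε)
    (hε1 : ε ≤ 1) (hl : 0 < Real.log ((N : ℝ) - K))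
    (hM : 8 * (1 + ε) * (K + M * v) * Real.log ((N : ℝ) - K) ≤ M) :
    1 - successProb c K M v (estimate T) ≤
      failureBound (ε / 80) (ε / 20) ε K (Real.log ((N : ℝ) - K)) := by
  have hKN' : 2 * (K : ℝ) < N := by exact_mod_cast hKN
  have hK' : (0 : ℝ) < K := by exact_mod_cast hK
  have hK1 : (1 : ℝ) ≤ K := by exact_mod_cast hK
  have hv : (0 : ℝ) ≤ v := v.2
  set l := Real.log ((N : ℝ) - K) with hld
  have hexp : Real.exp l = N - K := Real.exp_log (by linarith)
  have hN2 : (N : ℝ) ≤ 2 * Real.exp l := by rw [hexp]; linarith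
  have hKl : (K : ℝ) ≤ Real.exp l := by rw [hexp]; linarith
  have hMv : (0 : ℝ) ≤ M * v := by positivity
  have hM8 : 8 * K * l ≤ (M : ℝ) := by
    refine le_trans ?_ hM
    have : (K : ℝ) ≤ (1 + ε) * (K + M * v) := by nlinarith
    nlinarith
  have hM' : (0 : ℝ) < M := lt_of_lt_of_le (by positivity) hM8
  set δ := ε / 80 with hδd
  have hδ : 0 < δ := by positivity
  have hδ1 : δ ≤ 1 / 80 := by rw [hδd]; linarith
  -- The largest value that the hypothesis on M allows for (1 + δ)(K + Mv); it makes M / (2R) an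
  -- explicit multiple of l.
  set R : ℝ := (1 + δ) * M / (8 * (1 + ε) * l) with hRd
  have hs : 0 < √l := Real.sqrt_pos.2 hl
  have h2K : (2 : ℝ) ^ K ≤ Real.exp K := by
    have : (2 : ℝ) ≤ Real.exp 1 := by have := Real.add_one_le_exp 1; linarith
    calc (2 : ℝ) ^ K ≤ Real.exp 1 ^ K := by gcongr
      _ = Real.exp K := by rw [← Real.exp_nat_mul]; simp
  -- Here θ + η = 1/2, while the winner reaches 1 - δ - θ = 1/2 + ε/20 - δ; δ = ε/80 is small enough
  -- to keep the gap. The cutoff K / √l is o(K), so columns off `T` hardly see the few remaining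
  -- ones, yet its exponent, of order K√l, still beats 2^K.
  have h := one_sub_successProb_le (c := c) (v := v) (by exact_mod_cast hM') hK hc hT (δ := δ)
    (θ := 1 / 2 - ε / 20) (η := ε / 20) (m₀ := K / √l) (R := R) hδ (by linarith) (by linarith)
    (by rw [hδd]; nlinarith) (by positivity) (by linarith) (by positivity)
    (by rw [hRd, mul_div_assoc]
        gcongr
        rw [le_div_iff₀ (by positivity)]
        linarith)
  have hMR : (M : ℝ) / (2 * R) = 4 * (1 + ε) / (1 + δ) * l := by
    rw [hRd]; field_simp; norm_num
  refine h.trans ?_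
  have e1 : Real.exp (-(δ ^ 2 / 16) * M) ≤ Real.exp (-(δ ^ 2 / 2 * l * K)) := by
    refine Real.exp_le_exp.2 ?_
    nlinarith [mul_le_mul_of_nonneg_left hM8 (sq_nonneg δ)]
  have t1 : 2 ^ K * Real.exp (-(δ ^ 2 / 16) * M) ≤ Real.exp (K * (1 - δ ^ 2 / 2 * l)) := by
    calc _ ≤ Real.exp K * Real.exp (-(δ ^ 2 / 2 * l * K)) := by gcongr
      _ = _ := by rw [← Real.exp_add]; congr 1; ring
  have t2 : N * Real.exp (-(δ ^ 2 / 16) * M) ≤ 2 * Real.exp (l * (1 - δ ^ 2 / 2 * K)) := by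
    calc _ ≤ 2 * Real.exp l * Real.exp (-(δ ^ 2 / 2 * l * K)) := by gcongr
      _ = _ := by rw [mul_assoc, ← Real.exp_add]; congr 2; ring
  have t3 : Real.exp (-(δ ^ 2 / 16) * M) ≤ Real.exp (K * (1 - δ ^ 2 / 2 * l)) := by
    refine le_trans ?_ t1
    exact le_mul_of_one_le_left (Real.exp_pos _).le (one_le_pow₀ (by norm_num))
  have t4 : 2 ^ K * (2 * Real.exp (-(δ ^ 2 * (K / √l) * M / (2 * R)))) ≤
      2 * Real.exp (K * (1 - 2 * δ ^ 2 * √l)) := by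
    have hq : 2 ≤ 4 * (1 + ε) / (1 + δ) := by rw [le_div_iff₀ (by positivity)]; linarith
    have : 2 * δ ^ 2 * √l * K ≤ δ ^ 2 * (K / √l) * M / (2 * R) := by
      rw [mul_div_assoc, hMR]
      have e : δ ^ 2 * (K / √l) * (4 * (1 + ε) / (1 + δ) * l) =
          4 * (1 + ε) / (1 + δ) * (δ ^ 2 * √l * K) := by
        have : l / √l = √l := Real.div_sqrt
        linear_combination 4 * (1 + ε) / (1 + δ) * δ ^ 2 * K * this
      rw [e]
      have := mul_le_mul_of_nonneg_right hq (by positivity : 0 ≤ δ ^ 2 * √l * K)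
      linarith
    calc _ ≤ Real.exp K * (2 * Real.exp (-(2 * δ ^ 2 * √l * K))) := by gcongr
      _ = 2 * (Real.exp K * Real.exp (-(2 * δ ^ 2 * √l * K))) := by ring
      _ = _ := by rw [← Real.exp_add]; congr 2; ring
  -- The critical term: θ² · 4(1 + ε) / (1 + δ) exceeds 1 only by a margin of order ε, and the union
  -- costs exp l up to a constant.
  have t5 : N * (2 * Real.exp (-((1 / 2 - ε / 20) ^ 2 * M / (2 * R)))) ≤
      4 * Real.exp (l * (-(ε / 2))) := by
    have : (1 + ε / 2) * l ≤ (1 / 2 - ε / 20) ^ 2 * M / (2 * R) := by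
      rw [mul_div_assoc, hMR, ← mul_assoc]
      gcongr
      rw [← mul_div_assoc, le_div_iff₀ (by positivity), hδd]
      nlinarith [mul_nonneg hε.le (sub_nonneg.2 hε1), pow_pos hε 3]
    calc _ ≤ 2 * Real.exp l * (2 * Real.exp (-((1 + ε / 2) * l))) := by gcongr
      _ = 4 * (Real.exp l * Real.exp (-((1 + ε / 2) * l))) := by ring
      _ = _ := by rw [← Real.exp_add]; congr 2; ring
  -- The union over iterations and columns costs exp(2l) up to a constant; (4/5)² · 4 = 2.56 leaves
  -- room for 12/5.
  have t6 : K * (N * (2 * Real.exp (-((4 / 5) ^ 2 * M / (2 * R))))) ≤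
      4 * Real.exp (l * (-(2 / 5))) := by
    have : 12 / 5 * l ≤ (4 / 5) ^ 2 * M / (2 * R) := by
      rw [mul_div_assoc, hMR, ← mul_assoc]
      gcongr
      rw [← mul_div_assoc, le_div_iff₀ (by positivity)]
      linarith
    calc _ ≤ Real.exp l * (2 * Real.exp l * (2 * Real.exp (-(12 / 5 * l)))) := by gcongr
      _ = 4 * (Real.exp l * Real.exp l * Real.exp (-(12 / 5 * l))) := by ring
      _ = _ := by rw [← Real.exp_add, ← Real.exp_add]; congr 2; ring
  have t7 : K * (N * (2 * Real.exp (-((ε / 20) ^ 2 * M / (2 * ((1 + δ) * (K / √l))))))) ≤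
      4 * Real.exp (l * (2 - 2 * (ε / 20) ^ 2 * √l)) := by
    have : 2 * (ε / 20) ^ 2 * √l * l ≤ (ε / 20) ^ 2 * M / (2 * ((1 + δ) * (K / √l))) := by
      rw [le_div_iff₀ (by positivity)]
      have e : 2 * (ε / 20) ^ 2 * √l * l * (2 * ((1 + δ) * (K / √l))) =
          (ε / 20) ^ 2 * (4 * (1 + δ) * K * l) := by field_simp; norm_num
      rw [e]
      gcongr
      refine le_trans ?_ hM8
      gcongr
      linarith
    calc _ ≤ Real.exp l * (2 * Real.exp l * (2 * Real.exp (-(2 * (ε / 20) ^ 2 * √l * l)))) := by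
          gcongr
      _ = 4 * (Real.exp l * Real.exp l * Real.exp (-(2 * (ε / 20) ^ 2 * √l * l))) := by ring
      _ = _ := by rw [← Real.exp_add, ← Real.exp_add]; congr 2; ring
  unfold failureBound
  linarith

lemma successProb_le_one {N : ℕ} (c : Finset (Fin N) → Fin N) (K M : ℕ) (v : ℝ≥0)
    (x : Fin N → ℝ) : successProb c K M v x ≤ 1 :=
  measureReal_le_one

/-- Exact recovery under the explicit sufficient number of measurements. -/
theorem tendsto_successProb (ε : ℝ) (hε : 0 < ε)
    (N K M : ℕ → ℕ) (v : ℕ → ℝ≥0)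
    (x : ∀ i, Fin (N i) → ℝ) (c : ∀ i, Finset (Fin (N i)) → Fin (N i))
    (hN : Tendsto N atTop atTop) (hK : Tendsto K atTop atTop)
    (hKN : ∀ i, 2 * K i < N i)
    (hx : ∀ i, IsBinarySparse (K i) (x i))
    (hc : ∀ i, ∀ A : Finset (Fin (N i)), A.Nonempty → c i A ∈ A)
    (hM : ∀ i, (1 + ε) * (2 * (4 * (K i : ℝ) - 2 + 4 * ((M i : ℝ) * (v i : ℝ)))) *
      Real.log ((N i : ℝ) - (K i : ℝ)) ≤ (M i : ℝ)) :
    Tendsto (fun i => successProb (c i) (K i) (M i) (v i) (x i)) atTop (𝓝 1) := by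
  -- Half of ε is given up to absorb the summand -2 in the hypothesis on M, which works once K ≥ (1
  -- + ε) / ε.
  set ε' := min (ε / 2) 1 with hε'd
  have hε' : 0 < ε' := lt_min (by positivity) one_pos
  have hε'1 : ε' ≤ 1 := min_le_right _ _
  have hε'2 : ε' ≤ ε / 2 := min_le_left _ _
  have hKr : Tendsto (fun i => (K i : ℝ)) atTop atTop := tendsto_natCast_atTop_atTop.comp hK
  have hNr : Tendsto (fun i => (N i : ℝ)) atTop atTop := tendsto_natCast_atTop_atTop.comp hN
  have hKN' : ∀ i, 2 * (K i : ℝ) < N i := fun i => by exact_mod_cast hKN i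
  have hNK : Tendsto (fun i => (N i : ℝ) - K i) atTop atTop :=
    tendsto_atTop_mono (fun i => by linarith [hKN' i]) (hNr.atTop_div_const two_pos)
  have hl : Tendsto (fun i => Real.log ((N i : ℝ) - K i)) atTop atTop :=
    Real.tendsto_log_atTop.comp hNK
  have hbound := tendsto_failureBound (δ := ε' / 80) (γ := ε' / 20) (ε := ε') (by positivity)
    (by positivity) hε' hKr hl
  have hlow : Tendsto (fun i => 1 - failureBound (ε' / 80) (ε' / 20) ε' (K i)
      (Real.log ((N i : ℝ) - K i))) atTop (𝓝 1) := by
    simpa using hbound.const_sub 1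
  refine tendsto_of_tendsto_of_tendsto_of_le_of_le' hlow tendsto_const_nhds ?_
    (Eventually.of_forall fun i => successProb_le_one _ _ _ _ _)
  filter_upwards [hK.eventually_ge_atTop 1, hKr.eventually_ge_atTop ((1 + ε) / ε),
    hl.eventually_gt_atTop 0] with i h1 h2 h3
  obtain ⟨T, hT, hxT⟩ := (hx i).exists_support
  rw [hxT]
  have hMi : 8 * (1 + ε') * (K i + M i * v i) * Real.log ((N i : ℝ) - K i) ≤ M i := by
    refine le_trans (mul_le_mul_of_nonneg_right ?_ h3.le) (hM i)
    rw [div_le_iff₀ hε] at h2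
    have hMv : (0 : ℝ) ≤ M i * v i := by positivity
    have h4 : ε' * (K i + M i * v i) ≤ ε / 2 * (K i + M i * v i) := by gcongr
    nlinarith
  have := one_sub_successProb_le_failureBound (by omega) (hKN i) (hc i) hT hε' hε'1 h3 hMi
  linarith

end MAPMP

theorem theorem1 :
    -- the explicit sufficient number of measurements, for every fixed `ε > 0`
    (∀ ε : ℝ, 0 < ε →
      ∀ (N K M : ℕ → ℕ) (v : ℕ → ℝ≥0)
        (x : ∀ i, Fin (N i) → ℝ) (c : ∀ i, Finset (Fin (N i)) → Fin (N i)),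
        Tendsto N atTop atTop → Tendsto K atTop atTop →
        (∀ i, 2 * K i < N i) →
        (∀ i, MAPMP.IsBinarySparse (K i) (x i)) →
        (∀ i, ∀ A : Finset (Fin (N i)), A.Nonempty → c i A ∈ A) →
        (∀ i, (1 + ε) * (2 * (4 * (K i : ℝ) - 2 + 4 * ((M i : ℝ) * (v i : ℝ)))) *
            Real.log ((N i : ℝ) - (K i : ℝ)) ≤ (M i : ℝ)) →
        Tendsto (fun i => MAPMP.successProb (c i) (K i) (M i) (v i) (x i)) atTop (𝓝 1)) ∧
    -- the scaling law: a number of measurements of order `(K + M v) ln N` suffices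
    (∃ C : ℝ, 0 < C ∧
      ∀ (N K M : ℕ → ℕ) (v : ℕ → ℝ≥0)
        (x : ∀ i, Fin (N i) → ℝ) (c : ∀ i, Finset (Fin (N i)) → Fin (N i)),
        Tendsto N atTop atTop → Tendsto K atTop atTop →
        (∀ i, 2 * K i < N i) →
        (∀ i, MAPMP.IsBinarySparse (K i) (x i)) →
        (∀ i, ∀ A : Finset (Fin (N i)), A.Nonempty → c i A ∈ A) →
        (∀ i, C * ((K i : ℝ) + (M i : ℝ) * (v i : ℝ)) * Real.log (N i : ℝ) ≤ (M i : ℝ)) →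
        Tendsto (fun i => MAPMP.successProb (c i) (K i) (M i) (v i) (x i)) atTop (𝓝 1)) := by
  -- The explicit condition with ε = 1 has leading coefficient 2 · 2 · 4 = 16.
  refine ⟨MAPMP.tendsto_successProb, 16, by norm_num, ?_⟩
  intro N K M v x c hN hK hKN hx hc hM
  refine MAPMP.tendsto_successProb 1 one_pos N K M v x c hN hK hKN hx hc fun i => ?_
  refine le_trans ?_ (hM i)
  have h1 : 2 * (K i : ℝ) + 1 ≤ N i := by exact_mod_cast hKN i
  have hK0 : (0 : ℝ) ≤ K i := by positivity
  have hlog0 : 0 ≤ Real.log ((N i : ℝ) - K i) := Real.log_nonneg (by linarith)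
  have hlog : Real.log ((N i : ℝ) - K i) ≤ Real.log (N i) :=
    Real.log_le_log (by linarith) (by linarith)
  have hMv : (0 : ℝ) ≤ (M i : ℝ) * (v i : ℝ) := by positivity
  calc _ ≤ 16 * ((K i : ℝ) + (M i : ℝ) * (v i : ℝ)) * Real.log ((N i : ℝ) - K i) := by
        refine mul_le_mul_of_nonneg_right ?_ hlog0
        linarith
    _ ≤ _ := by gcongr
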